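/- Let $n\ge 2$, $1<\rho<n$, $\alpha\ge\frac{\rho n}{\rho n+\rho-n}$, $1<\alpha<\beta<n$, $\alpha<p<+\infty$, $q=\frac{p}{1-\alpha/\beta}$ and $K\ge 0$. There is a finite constant $C$, depending only on $n,\rho,\alpha,\beta,p,K$, with the following property. Let $w:(0,\infty)\to[0,\infty)$ be a measurable weight in the Ariño–Muckenhoupt class $B_{p/\alpha}$ with constant $K$, i.e. $\int_r^{\infty}(r/t)^{p/\alpha}w(t)\,dt\le K\int_0^r w(t)\,dt$ for all $r>0$. Let $\Omega\in L^1(\mathbb S^{n-1})\cap L^\rho(\mathbb S^{n-1})$ be real-valued with $\int_{\mathbb S^{n-1}}\Omega\,d\sigma=0$. Let $f:\mathbb R^n\to\mathbb R$ be locally integrable with a locally integrable weak gradient $\nabla f$ such that $$\|\nabla f\|_{\dot{\mathcal M}^{\alpha,\alpha n/\beta}}<\infty,\qquad \|\nabla f\|_{\Lambda^p(w)}<\infty .$$ Here $\|g\|_{\dot{\mathcal M}^{a,b}}=\sup_{x\in\mathbb R^n,\,r>0}\Big(r^{-n(1-a/b)}\int_{B(x,r)}|g(y)|^a\,dy\Big)^{1/a}$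 is the homogeneous Morrey norm, and $\|g\|_{\Lambda^s(w)}=\Big(\int_0^\infty g^*(t)^s\,w(t)\,dt\Big)^{1/s}$ is the classical Lorentz functional, where $g^*(t)=\inf\{\lambda\ge 0: |\{|g|>\lambda\}|\le t\}$ is the non-increasing rearrangement. Then for almost every $x$ the principal value $$T_\Omega f(x)=\mathrm{p.v.}\int_{\mathbb R^n}\frac{\Omega(y/|y|)}{|y|^n}f(x-y)\,dy=\lim_{\varepsilon\to0^+,\,R\to\infty}\int_{\varepsilon<|y|<R}\frac{\Omega(y/|y|)}{|y|^n}f(x-y)\,dy$$ exists (with absolutely convergent integrals over the annuli), and $$\|T_\Omega f\|_{\Lambda^q(w)}\le C\,\|\Omega\|_{L^\rho(\mathbb S^{n-1})}\,\|\nabla f\|_{\dot{\mathcal M}^{\alpha,\alpha n/\beta}}^{\alpha/\beta}\,\|\nabla f\|_{\Lambda^p(w)}^{1-\alpha/\beta}.$$ -/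

import Mathlib

open MeasureTheory Set Filter Topology
open scoped NNReal ENNReal ContDiff

noncomputable section

/-- The Euclidean space `ℝⁿ`. -/
abbrev Eucl (n : ℕ) : Type := EuclideanSpace ℝ (Fin n)

/-- The unit sphere of `ℝⁿ`. -/
abbrev UnitSph (n : ℕ) : Type := Metric.sphere (0 : Eucl n) 1

/-- The surface measure on the unit sphere (total mass `n · |B(0,1)|`). -/
def surfaceMeasure (n : ℕ) : Measure (UnitSph n) := (volume : Measure (Eucl n)).toSphere

/-- The value `Ω (y / |y|)`, and `0` at the origin. -/
def homogExt {n : ℕ} (Ω : UnitSph n → ℝ) (y : Eucl n) : ℝ :=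
  if h : y = 0 then 0 else
    Ω ⟨‖y‖⁻¹ • y, by
      rw [mem_sphere_zero_iff_norm, norm_smul, norm_inv, norm_norm,
        inv_mul_cancel₀ (norm_ne_zero_iff.mpr h)]⟩

/-- The integrand `Ω (y / |y|) |y|⁻ⁿ f (x - y)` of the rough singular integral. -/
def roughIntegrand {n : ℕ} (Ω : UnitSph n → ℝ) (f : Eucl n → ℝ) (x y : Eucl n) : ℝ :=
  homogExt Ω y / ‖y‖ ^ n * f (x - y)

/-- The annulus `{ε < |y| < R}`. -/
def annulus (n : ℕ) (ε R : ℝ) : Set (Eucl n) := {y | ε < ‖y‖ ∧ ‖y‖ < R}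

/-- The integral of the rough kernel over the annulus `{ε < |y| < R}`. -/
def truncRough {n : ℕ} (Ω : UnitSph n → ℝ) (f : Eucl n → ℝ) (x : Eucl n) (ε R : ℝ) : ℝ :=
  ∫ y in annulus n ε R, roughIntegrand Ω f x y

/-- `L` is the principal value of `∫ Ω (y / |y|) |y|⁻ⁿ f (x - y) dy`: the integrals over the
annuli `{ε < |y| < R}` converge absolutely and tend to `L` as `ε → 0` and `R → ∞`. -/
def IsRoughPV {n : ℕ} (Ω : UnitSph n → ℝ) (f : Eucl n → ℝ) (x : Eucl n) (L : ℝ) : Prop :=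
  (∀ ε R : ℝ, 0 < ε → IntegrableOn (roughIntegrand Ω f x) (annulus n ε R) volume) ∧
    Tendsto (fun q : ℝ × ℝ => truncRough Ω f x q.1 q.2) (𝓝[>] (0 : ℝ) ×ˢ atTop) (𝓝 L)

/-- The rough singular integral operator `T_Ω f (x) = p.v. ∫ Ω (y / |y|) |y|⁻ⁿ f (x - y) dy`;
meaningful at the points `x` with `∃ L, IsRoughPV Ω f x L`. -/
def roughOp {n : ℕ} (Ω : UnitSph n → ℝ) (f : Eucl n → ℝ) (x : Eucl n) : ℝ :=
  limUnder (𝓝[>] (0 : ℝ) ×ˢ atTop) (fun q : ℝ × ℝ => truncRough Ω f x q.1 q.2)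

/-- `g` is the weak gradient of the locally integrable function `f`. -/
def HasWeakGradient {n : ℕ} (f : Eucl n → ℝ) (g : Eucl n → Eucl n) : Prop :=
  LocallyIntegrable f volume ∧ LocallyIntegrable g volume ∧
    ∀ φ : Eucl n → ℝ, ContDiff ℝ ∞ φ → HasCompactSupport φ → ∀ v : Eucl n,
      ∫ x, f x * fderiv ℝ φ x v = -∫ x, inner ℝ (g x) v * φ x

/-- The homogeneous Morrey (quasi-)norm
`sup_{x, r > 0} (r^{-n(1 - p/q)} ∫_{B(x,r)} |g|^p)^{1/p}`, with values in `[0, ∞]`. -/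
def morreyNorm {n : ℕ} {F : Type*} [NormedAddCommGroup F] (p q : ℝ) (g : Eucl n → F) : ℝ≥0∞ :=
  ⨆ (x : Eucl n) (r : ℝ) (_ : 0 < r),
    (ENNReal.ofReal (r ^ (-((n : ℝ) * (1 - p / q)))) *
      ∫⁻ y in Metric.ball x r, ‖g y‖ₑ ^ p) ^ (1 / p)

/-- The non-increasing rearrangement `g^*(t) = inf {s ≥ 0 : |{|g| > s}| ≤ t}`
(with `inf ∅ = ∞`). -/
def rearrangement {n : ℕ} {F : Type*} [NormedAddCommGroup F] (g : Eucl n → F) (t : ℝ) : ℝ≥0∞ :=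
  sInf {s : ℝ≥0∞ | volume {x | s < ‖g x‖ₑ} ≤ ENNReal.ofReal t}

/-- The functional `(∫₀^∞ g^*(t)^p w(t) dt)^{1/p}` of the classical Lorentz space `Λ^p(w)`. -/
def lorentzNorm {n : ℕ} {F : Type*} [NormedAddCommGroup F] (p : ℝ) (w : ℝ → ℝ≥0)
    (g : Eucl n → F) : ℝ≥0∞ :=
  (∫⁻ t in Ioi (0 : ℝ), rearrangement g t ^ p * (w t : ℝ≥0∞)) ^ (1 / p)

/-- The weight `w` on `(0, ∞)` satisfies the Ariño–Muckenhoupt condition `B_p` with constant `K`;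
`w ∈ B_p` means that this holds for some finite `K`. Only the values of `w` on `(0, ∞)` matter. -/
def IsBpWeight (p : ℝ) (K : ℝ≥0) (w : ℝ → ℝ≥0) : Prop :=
  AEMeasurable w (volume.restrict (Ioi (0 : ℝ))) ∧
    ∀ r : ℝ, 0 < r →
      ∫⁻ t in Ioi r, ENNReal.ofReal ((r / t) ^ p) * (w t : ℝ≥0∞) ≤
        (K : ℝ≥0∞) * ∫⁻ t in Ioc (0 : ℝ) r, (w t : ℝ≥0∞)

end

/-! The heart of the proof is a pointwise estimate of Hedberg type. Write G = |∇f|^α, M for the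
centred maximal operator, N for the Morrey norm and θ = α/β. Wherever MG(x) is finite, the principal
value exists and |T_Ω f(x)| ≤ C ‖Ω‖_ρ N^θ MG(x)^((1-θ)/α) (`exists_roughPV_le`).

To see this, take an annulus a < |y| < b with b ≤ 2a. Since Ω has mean zero, a constant may be
subtracted from f at no cost. Hölder's inequality with exponents ρ, ρ' and the Sobolev–Poincaré
inequality then bound the annular integral by C ‖Ω‖_ρ b^(1-n/α) (∫_{B(x,3b)} G)^(1/α)
(`exists_truncRough_le`). The lower bound on α says exactly that α is at least the exponent whose
Sobolev conjugate is ρ'. The integral of G over the ball is at most C b^n MG(x), which turns the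
bound into P b, and also at most C b^(n-β) N^α, which turns it into Q b^(-(β/α-1)). The first bound
is summable over small dyadic scales and the second over large ones, so the limit exists
(`exists_tendsto_of_dyadic_bounds`). Splitting at a radius t and optimising in t gives the product
P^(1-θ) Q^θ (`le_rpow_mul_rpow_of_forall_le`).

Finiteness of MG almost everywhere follows from the Morrey bound at large scales and the weak (1,1)
inequality at small ones.

It remains to pass to rearrangements. The pointwise estimate gives (T_Ω f)^* ≤ c ((MG)^*)^((1-θ)/α),
and raising to the power q leaves (MG)^* to the power s = p/α. Now (MG)^*(t) is at most a constant
times the mean of G^* over (0,t] (`decRearr_hlMax_le`), and the B_s condition yields Hardy's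
inequality for means of non-increasing functions in L^s(w) (`hardy_of_isBpWeight`). Finally (G^*)^s
≤ ((∇f)^*)^p. -/

/-! ### Layer cake formula. -/

theorem volume_Ioi_ofReal_lt (a : ℝ≥0∞) :
    volume ({l : ℝ | ENNReal.ofReal l < a} ∩ Ioi 0) = a := by
  induction a with
  | top => simp
  | coe a =>
    have : {l : ℝ | ENNReal.ofReal l < (a : ℝ≥0∞)} ∩ Ioi 0 = Ioo 0 (a : ℝ) := by
      ext l
      simp only [mem_inter_iff, mem_ofPred_eq, mem_Ioi, mem_Ioo]
      constructor
      · rintro ⟨h1, h2⟩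
        refine ⟨h2, ?_⟩
        rw [← ENNReal.ofReal_coe_nnreal] at h1
        exact (ENNReal.ofReal_lt_ofReal_iff_of_nonneg h2.le).1 h1
      · rintro ⟨h1, h2⟩
        refine ⟨?_, h1⟩
        rw [← ENNReal.ofReal_coe_nnreal]
        exact (ENNReal.ofReal_lt_ofReal_iff_of_nonneg h1.le).2 h2
    rw [this, Real.volume_Ioo]
    simp

/-- The layer cake formula for functions with values in `[0, ∞]`. -/
theorem lintegral_eq_lintegral_measure_ofReal_lt {X : Type*} [MeasurableSpace X] (μ : Measure X)
    [SFinite μ] {F : X → ℝ≥0∞} (hF : AEMeasurable F μ) :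
    ∫⁻ x, F x ∂μ = ∫⁻ l in Ioi (0 : ℝ), μ {x | ENNReal.ofReal l < F x} := by
  wlog hm : Measurable F generalizing F
  · rw [lintegral_congr_ae hF.ae_eq_mk, this hF.measurable_mk.aemeasurable hF.measurable_mk]
    refine lintegral_congr fun l => measure_congr (eventuallyEq_set.2 ?_)
    filter_upwards [hF.ae_eq_mk] with x hx
    simp only [hx]
  have hS : MeasurableSet {z : X × ℝ | ENNReal.ofReal z.2 < F z.1} :=
    measurableSet_lt (by fun_prop) (by fun_prop)
  calc ∫⁻ x, F x ∂μ
      = ∫⁻ x, (∫⁻ l in Ioi (0 : ℝ),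
          {z : X × ℝ | ENNReal.ofReal z.2 < F z.1}.indicator 1 (x, l)) ∂μ := by
        refine lintegral_congr fun x => ?_
        have : ∀ l : ℝ, {z : X × ℝ | ENNReal.ofReal z.2 < F z.1}.indicator
            (1 : X × ℝ → ℝ≥0∞) (x, l) = {l : ℝ | ENNReal.ofReal l < F x}.indicator 1 l := by
          intro l; simp [indicator]
        simp_rw [this]
        rw [lintegral_indicator_one (measurableSet_lt (by fun_prop) (by fun_prop)),
          Measure.restrict_apply (measurableSet_lt (by fun_prop) (by fun_prop)),
          volume_Ioi_ofReal_lt]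
    _ = ∫⁻ l in Ioi (0 : ℝ), ∫⁻ x,
          {z : X × ℝ | ENNReal.ofReal z.2 < F z.1}.indicator 1 (x, l) ∂μ := by
        refine lintegral_lintegral_swap ?_
        exact (measurable_one.indicator hS).aemeasurable
    _ = _ := by
        refine lintegral_congr fun l => ?_
        have : ∀ x : X, {z : X × ℝ | ENNReal.ofReal z.2 < F z.1}.indicator
            (1 : X × ℝ → ℝ≥0∞) (x, l) = {x : X | ENNReal.ofReal l < F x}.indicator 1 x := by
          intro l; simp [indicator]
        simp_rw [this]
        rw [lintegral_indicator_one (measurableSet_lt (by fun_prop) (by fun_prop))]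

/-! ### Non-increasing rearrangements. -/

section Rearrangement

variable {X : Type*} [MeasurableSpace X] (μ : Measure X)

/-- The non-increasing rearrangement of a function with values in `[0, ∞]`. -/
noncomputable def decRearr (F : X → ℝ≥0∞) (t : ℝ) : ℝ≥0∞ :=
  sInf {s : ℝ≥0∞ | μ {x | s < F x} ≤ ENNReal.ofReal t}

/-- The infimum is attained: along levels decreasing to it, the superlevel sets increase to the one
at the infimum, and the measure is continuous along increasing unions without any measurability of
F. -/
theorem measure_decRearr_lt_le (F : X → ℝ≥0∞) (t : ℝ) :
    μ {x | decRearr μ F t < F x} ≤ ENNReal.ofReal t := by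
  have hne : {s : ℝ≥0∞ | μ {x | s < F x} ≤ ENNReal.ofReal t}.Nonempty := ⟨⊤, by simp⟩
  obtain ⟨u, hu, hlim, hmem⟩ := exists_seq_tendsto_sInf hne (OrderBot.bddBelow _)
  have hsub : {x | decRearr μ F t < F x} ⊆ ⋃ k, {x | u k < F x} := by
    intro x hx
    obtain ⟨k, hk⟩ := (hlim.eventually (gt_mem_nhds hx)).exists
    exact mem_iUnion.2 ⟨k, hk⟩
  have hmono : Monotone fun k => {x | u k < F x} := fun i j hij x hx =>
    lt_of_le_of_lt (hu hij) hx
  refine (measure_mono hsub).trans ?_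
  rw [hmono.measure_iUnion]
  exact iSup_le hmem

theorem decRearr_le_iff (F : X → ℝ≥0∞) (t : ℝ) (s : ℝ≥0∞) :
    decRearr μ F t ≤ s ↔ μ {x | s < F x} ≤ ENNReal.ofReal t := by
  refine ⟨fun h => (measure_mono ?_).trans (measure_decRearr_lt_le μ F t), fun h => sInf_le h⟩
  intro x hx
  exact lt_of_le_of_lt h hx

theorem decRearr_antitone (F : X → ℝ≥0∞) : Antitone (decRearr μ F) := fun _ _ h =>
  (decRearr_le_iff μ F _ _).2
    ((measure_decRearr_lt_le μ F _).trans (ENNReal.ofReal_le_ofReal h))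

theorem decRearr_le_comp {F T : X → ℝ≥0∞} {φ : ℝ≥0∞ → ℝ≥0∞} (hφ : Monotone φ)
    (h : ∀ᵐ x ∂μ, T x ≤ φ (F x)) (t : ℝ) : decRearr μ T t ≤ φ (decRearr μ F t) := by
  rw [decRearr_le_iff]
  refine (measure_mono_ae ?_).trans (measure_decRearr_lt_le μ F t)
  filter_upwards [h] with x hx hlt
  by_contra hcon
  exact absurd (lt_of_lt_of_le hlt hx) (not_lt.2 (hφ (not_lt.1 hcon)))

/-- Levels are compared one by one. If d is the measure of {F - F^*(t) > l}, then d ≤ t, and F^*(r)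
> l for every r < d, because {F > l} contains that set. The subtraction is truncated at zero. -/
theorem lintegral_sub_decRearr_le [SFinite μ] {F : X → ℝ≥0∞} (hF : AEMeasurable F μ) {t : ℝ} :
    ∫⁻ x, (F x - decRearr μ F t) ∂μ ≤ ∫⁻ r in Ioc 0 t, decRearr μ F r := by
  rw [lintegral_eq_lintegral_measure_ofReal_lt μ (hF.sub_const _),
    lintegral_eq_lintegral_measure_ofReal_lt _ (decRearr_antitone μ F).measurable.aemeasurable]
  refine lintegral_mono fun l => ?_
  set c := decRearr μ F t
  set d := μ {x | ENNReal.ofReal l < F x - c} with hd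
  have hsub1 : ∀ x, ENNReal.ofReal l < F x - c → c < F x := fun x hx => by
    by_contra hcon
    rw [tsub_eq_zero_of_le (not_lt.1 hcon)] at hx
    exact not_lt_zero hx
  have hdt : d ≤ ENNReal.ofReal t :=
    (measure_mono fun x hx => hsub1 x hx).trans (measure_decRearr_lt_le μ F t)
  have hdtop : d ≠ ⊤ := (hdt.trans_lt ENNReal.ofReal_lt_top).ne
  have hset : Ioo 0 d.toReal ⊆ {r | ENNReal.ofReal l < decRearr μ F r} ∩ Ioc 0 t := by
    intro r hr
    have hrd : ENNReal.ofReal r < d := (ENNReal.ofReal_lt_iff_lt_toReal hr.1.le hdtop).2 hr.2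
    refine ⟨?_, hr.1, ?_⟩
    · show ENNReal.ofReal l < decRearr μ F r
      rw [← not_le, decRearr_le_iff, not_le]
      refine hrd.trans_le (measure_mono fun x hx => ?_)
      exact lt_of_lt_of_le (mem_ofPred_eq ▸ hx) tsub_le_self
    · by_contra hcon
      have := ENNReal.ofReal_le_ofReal (not_le.1 hcon).le
      exact absurd (hrd.trans_le hdt) (not_lt.2 this)
  rw [Measure.restrict_apply (measurableSet_lt measurable_const (decRearr_antitone μ F).measurable)]
  refine le_trans ?_ (measure_mono hset)
  rw [Real.volume_Ioo, sub_zero, ENNReal.ofReal_toReal hdtop]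

end Rearrangement

/-! ### Hardy's inequality for Ariño–Muckenhoupt weights. -/

/-- A lower set of the half-line is, up to a null set, an interval (0,b] or the increasing union of
all (0,n]. -/
theorem setLIntegral_le_of_lowerSet {φ ψ : ℝ → ℝ≥0∞} {C : ℝ≥0}
    (h : ∀ x : ℝ, 0 < x → ∫⁻ t in Ioc 0 x, φ t ≤ C * ∫⁻ t in Ioc 0 x, ψ t)
    {D : Set ℝ} (hD0 : D ⊆ Ioi 0) (hD : ∀ x ∈ D, ∀ y, 0 < y → y ≤ x → y ∈ D) :
    ∫⁻ t in D, φ t ≤ C * ∫⁻ t in D, ψ t := by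
  by_cases hb : BddAbove D
  · rcases D.eq_empty_or_nonempty with rfl | hne
    · simp
    set b := sSup D
    have hb0 : 0 < b := by
      obtain ⟨x, hx⟩ := hne
      exact lt_of_lt_of_le (hD0 hx) (le_csSup hb hx)
    have h1 : Ioo 0 b ⊆ D := fun y hy => by
      obtain ⟨x, hx, hyx⟩ := exists_lt_of_lt_csSup hne hy.2
      exact hD x hx y hy.1 hyx.le
    have h2 : D ⊆ Ioc 0 b := fun y hy => ⟨hD0 hy, le_csSup hb hy⟩
    have hae : D =ᵐ[volume] Ioc 0 b := by
      refine Filter.EventuallyLE.antisymm (LE.le.eventuallyLE h2) ?_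
      exact Ioo_ae_eq_Ioc.symm.le.trans (LE.le.eventuallyLE h1)
    rw [setLIntegral_congr hae, setLIntegral_congr hae]
    exact h b hb0
  · have hDeq : D = ⋃ n : ℕ, Ioc (0 : ℝ) n := by
      ext y
      simp only [mem_iUnion, mem_Ioc]
      constructor
      · intro hy
        obtain ⟨n, hn⟩ := exists_nat_ge y
        exact ⟨n, hD0 hy, hn⟩
      · rintro ⟨n, hy0, -⟩
        obtain ⟨x, hx, hyx⟩ := not_bddAbove_iff.1 hb y
        exact hD x hx y hy0 hyx.le
    have hdir : Directed (· ⊆ ·) fun n : ℕ => Ioc (0 : ℝ) n := by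
      refine Monotone.directed_le fun i j hij => ?_
      exact Ioc_subset_Ioc_right (by exact_mod_cast hij)
    rw [hDeq, setLIntegral_iUnion_of_directed _ hdir, setLIntegral_iUnion_of_directed _ hdir]
    refine iSup_le fun n => ?_
    rcases Nat.eq_zero_or_pos n with rfl | hn
    · simp
    refine (h n (by exact_mod_cast hn)).trans ?_
    gcongr
    exact le_iSup (fun n : ℕ => ∫⁻ t in Ioc (0 : ℝ) n, ψ t) n

/-- Domination of the primitives implies domination of the integrals against
non-increasing functions. -/
theorem lintegral_antitone_mul_le {φ ψ H : ℝ → ℝ≥0∞} {C : ℝ≥0} (hφ : Measurable φ)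
    (hψ : Measurable ψ) (hH : AntitoneOn H (Ioi 0))
    (h : ∀ x : ℝ, 0 < x → ∫⁻ t in Ioc 0 x, φ t ≤ C * ∫⁻ t in Ioc 0 x, ψ t) :
    ∫⁻ t in Ioi 0, H t * φ t ≤ C * ∫⁻ t in Ioi 0, H t * ψ t := by
  have hHm : AEMeasurable H (volume.restrict (Ioi 0)) :=
    aemeasurable_restrict_of_antitoneOn measurableSet_Ioi hH
  -- Layer cake for H against the measure χ dt. The superlevel sets of a non-increasing H are lower
  -- sets, on which the hypothesis applies.
  have key : ∀ χ : ℝ → ℝ≥0∞, Measurable χ → ∫⁻ t in Ioi 0, H t * χ t =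
      ∫⁻ l in Ioi (0 : ℝ), ∫⁻ t in {t | ENNReal.ofReal l < H t} ∩ Ioi 0, χ t := by
    intro χ hχ
    have h1 := lintegral_withDensity_eq_lintegral_mul₀ hχ.aemeasurable hHm
    have h2 := lintegral_eq_lintegral_measure_ofReal_lt
      ((volume.restrict (Ioi (0 : ℝ))).withDensity χ)
      (hHm.mono_ac (withDensity_absolutelyContinuous _ _))
    rw [h2] at h1
    rw [show (∫⁻ t in Ioi 0, H t * χ t) = ∫⁻ t in Ioi 0, (χ * H) t from
      lintegral_congr fun t => by simp [mul_comm], ← h1]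
    refine lintegral_congr fun l => ?_
    rw [withDensity_apply' , Measure.restrict_restrict₀']
    exact measurableSet_Ioi.nullMeasurableSet
  rw [key φ hφ, key ψ hψ]
  refine (lintegral_mono (g := fun l => C *
    ∫⁻ t in {t | ENNReal.ofReal l < H t} ∩ Ioi 0, ψ t) fun l => ?_).trans ?_
  · refine setLIntegral_le_of_lowerSet h inter_subset_right ?_
    rintro x ⟨hx1, hx2⟩ y hy hyx
    exact ⟨lt_of_lt_of_le (show ENNReal.ofReal l < H x from hx1) (hH hy hx2 hyx), hy⟩
  · rw [lintegral_const_mul' _ _ ENNReal.coe_ne_top]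

/-- `(∫_(0,t] h)^s ≤ 2^s ∫_(0,t] (∫_(0,r] h)^(s-1) h(r) dr` for bounded `h`. -/
theorem rpow_lintegral_le {h : ℝ → ℝ≥0∞} (hm : Measurable h) {N : ℝ≥0} (hN : ∀ t, h t ≤ N)
    {s : ℝ} (hs : 1 < s) (t : ℝ) (ht : 0 < t) :
    (∫⁻ r in Ioc 0 t, h r) ^ s ≤
      2 ^ s * ∫⁻ r in Ioc 0 t, (∫⁻ u in Ioc 0 r, h u) ^ (s - 1) * h r := by
  set P : ℝ → ℝ≥0∞ := fun r => ∫⁻ u in Ioc 0 r, h u with hP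
  have hadd : ∀ x y, P x ≤ P y + ENNReal.ofReal (N * dist x y) := by
    intro x y
    calc P x ≤ ∫⁻ u in Ioc 0 y ∪ Ioc y x, h u :=
          lintegral_mono_set Ioc_subset_Ioc_union_Ioc
      _ ≤ P y + ∫⁻ u in Ioc y x, h u := lintegral_union_le _ _ _
      _ ≤ P y + ∫⁻ u in Ioc y x, N := by gcongr with u; exact hN u
      _ ≤ _ := by
        gcongr
        rw [setLIntegral_const, Real.volume_Ioc, ENNReal.ofReal_mul (p := (N : ℝ)) N.2,
          ENNReal.ofReal_coe_nnreal]
        gcongr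
        exact le_abs_self _
  have hfin : ∀ x, P x ≠ ⊤ := fun x => by
    refine ((hadd x 0).trans_lt ?_).ne
    have h0 : P 0 = 0 := by simp [hP]
    rw [h0]
    finiteness
  have hcont : Continuous fun x => (P x).toReal := by
    refine (LipschitzWith.of_le_add_mul N fun x y => ?_).continuous
    have := ENNReal.toReal_mono (by finiteness [hfin y]) (hadd x y)
    rwa [ENNReal.toReal_add (hfin y) ENNReal.ofReal_ne_top,
      ENNReal.toReal_ofReal (by positivity)] at this
  -- The primitive P is Lipschitz because h is bounded, so it takes half its final value at some m.
  -- The other half of the mass lies in (m,t], where P is at least P(t)/2.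
  have hmid : (P t).toReal / 2 ∈ Icc (P 0).toReal (P t).toReal := by
    have : 0 ≤ (P t).toReal := ENNReal.toReal_nonneg
    constructor
    · have h0 : P 0 = 0 := by simp [hP]
      rw [h0, ENNReal.toReal_zero]
      positivity
    · linarith
  obtain ⟨m, hm1, hm2⟩ := intermediate_value_Icc ht.le hcont.continuousOn hmid
  replace hm2 : (P m).toReal = (P t).toReal / 2 := hm2
  have hPm : P m = P t / 2 := by
    rw [← ENNReal.ofReal_toReal (hfin m), hm2, ENNReal.ofReal_div_of_pos (by norm_num),
      ENNReal.ofReal_toReal (hfin t)]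
    simp
  have hmass : P t / 2 ≤ ∫⁻ u in Ioc m t, h u := by
    have h1 : P t ≤ P m + ∫⁻ u in Ioc m t, h u :=
      (lintegral_mono_set Ioc_subset_Ioc_union_Ioc).trans (lintegral_union_le _ _ _)
    have h2 : P t / 2 + P t / 2 ≤ P t / 2 + ∫⁻ u in Ioc m t, h u := by
      rw [ENNReal.add_halves]; rwa [hPm] at h1
    exact (ENNReal.add_le_add_iff_left (by finiteness [hfin t])).1 h2
  have hlow : (P t / 2) ^ s ≤ ∫⁻ r in Ioc 0 t, P r ^ (s - 1) * h r := by
    calc (P t / 2) ^ s = (P t / 2) ^ (s - 1) * (P t / 2) := by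
          conv_lhs => rw [show s = (s - 1) + 1 by ring]
          rw [ENNReal.rpow_add_of_nonneg _ _ (by linarith) zero_le_one, ENNReal.rpow_one]
      _ ≤ (P t / 2) ^ (s - 1) * ∫⁻ u in Ioc m t, h u := by gcongr
      _ = ∫⁻ u in Ioc m t, (P t / 2) ^ (s - 1) * h u := (lintegral_const_mul _ hm).symm
      _ ≤ ∫⁻ u in Ioc m t, P u ^ (s - 1) * h u := by
          refine setLIntegral_mono' measurableSet_Ioc fun u hu => ?_
          rw [← hPm]
          have : P m ≤ P u := lintegral_mono_set (Ioc_subset_Ioc_right hu.1.le)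
          gcongr
      _ ≤ _ := lintegral_mono_set (Ioc_subset_Ioc_left hm1.1)
  calc P t ^ s = 2 ^ s * (P t / 2) ^ s := by
        rw [← ENNReal.mul_rpow_of_nonneg _ _ (by linarith), ENNReal.mul_div_cancel (by simp) (by simp)]
    _ ≤ _ := by gcongr

theorem lintegral_triangle_swap {κ Ψ : ℝ → ℝ≥0∞} (hκ : Measurable κ) (hΨ : Measurable Ψ) :
    ∫⁻ t in Ioi (0 : ℝ), κ t * ∫⁻ r in Ioc 0 t, Ψ r =
      ∫⁻ r in Ioi (0 : ℝ), Ψ r * ∫⁻ t in Ici r, κ t := by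
  have hS : MeasurableSet {z : ℝ × ℝ | z.2 ≤ z.1} := measurableSet_le (by fun_prop) (by fun_prop)
  have hF : Measurable ({z : ℝ × ℝ | z.2 ≤ z.1}.indicator fun z => κ z.1 * Ψ z.2) :=
    (by fun_prop : Measurable fun z : ℝ × ℝ => κ z.1 * Ψ z.2).indicator hS
  calc _ = ∫⁻ t in Ioi (0 : ℝ), ∫⁻ r in Ioi (0 : ℝ),
        {z : ℝ × ℝ | z.2 ≤ z.1}.indicator (fun z => κ z.1 * Ψ z.2) (t, r) := by
        refine lintegral_congr fun t => ?_
        rw [← lintegral_const_mul _ hΨ, ← Iic_inter_Ioi,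
          ← Measure.restrict_restrict measurableSet_Iic, ← lintegral_indicator measurableSet_Iic]
        rfl
    _ = ∫⁻ r in Ioi (0 : ℝ), ∫⁻ t in Ioi (0 : ℝ),
        {z : ℝ × ℝ | z.2 ≤ z.1}.indicator (fun z => κ z.1 * Ψ z.2) (t, r) :=
        lintegral_lintegral_swap hF.aemeasurable
    _ = _ := by
        refine setLIntegral_congr_fun measurableSet_Ioi fun r hr => ?_
        have h1 : Ici r = Ici r ∩ Ioi 0 :=
          (inter_eq_left.2 (Ici_subset_Ioi.2 hr)).symm
        rw [← lintegral_const_mul _ hκ, h1,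
          ← Measure.restrict_restrict measurableSet_Ici, ← lintegral_indicator measurableSet_Ici]
        refine lintegral_congr fun t => ?_
        simp [indicator, mul_comm]

/-- The mean value of `h` over `(0, t]`. -/
noncomputable def lowerMean (h : ℝ → ℝ≥0∞) (t : ℝ) : ℝ≥0∞ :=
  (∫⁻ r in Ioc 0 t, h r) / ENNReal.ofReal t

theorem le_lowerMean {h : ℝ → ℝ≥0∞} (hh : Antitone h) {t : ℝ} (ht : 0 < t) :
    h t ≤ lowerMean h t := by
  rw [lowerMean, ENNReal.le_div_iff_mul_le (by simp [ht]) (by simp)]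
  calc h t * ENNReal.ofReal t = ∫⁻ r in Ioc 0 t, h t := by simp
    _ ≤ _ := setLIntegral_mono' measurableSet_Ioc fun r hr => hh hr.2

theorem lowerMean_antitoneOn {h : ℝ → ℝ≥0∞} (hh : Antitone h) :
    AntitoneOn (lowerMean h) (Ioi 0) := by
  intro a ha b hb hab
  replace ha : 0 < a := ha
  replace hb : 0 < b := hb
  rw [lowerMean, ENNReal.div_le_iff_le_mul (by simp [hb]) (by simp)]
  calc ∫⁻ r in Ioc 0 b, h r ≤ (∫⁻ r in Ioc 0 a, h r) + ∫⁻ r in Ioc a b, h r :=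
        (lintegral_mono_set Ioc_subset_Ioc_union_Ioc).trans (lintegral_union_le _ _ _)
    _ ≤ (∫⁻ r in Ioc 0 a, h r) + ∫⁻ r in Ioc a b, lowerMean h a := by
        refine add_le_add le_rfl ?_
        exact setLIntegral_mono' measurableSet_Ioc fun r hr =>
          (hh hr.1.le).trans (le_lowerMean hh ha)
    _ = lowerMean h a * ENNReal.ofReal a + lowerMean h a * ENNReal.ofReal (b - a) := by
        rw [lowerMean, ENNReal.div_mul_cancel (by simp [ha]) (by simp)]
        simp
    _ = _ := by
        rw [← mul_add, ← ENNReal.ofReal_add ha.le (by linarith)]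
        congr 2; ring

theorem measurable_primitive (h : ℝ → ℝ≥0∞) : Measurable fun t => ∫⁻ r in Ioc 0 t, h r :=
  Monotone.measurable fun _ _ hab => lintegral_mono_set (Ioc_subset_Ioc_right hab)

theorem measurable_lowerMean (h : ℝ → ℝ≥0∞) : Measurable (lowerMean h) :=
  (measurable_primitive h).div (by fun_prop)

theorem lintegral_Ioc_rpow_le {s : ℝ} (hs : 1 < s) (x : ℝ) :
    ∫⁻ r in Ioc 0 x, ENNReal.ofReal r ^ (s - 1) ≤ ENNReal.ofReal x ^ s := by
  calc ∫⁻ r in Ioc 0 x, ENNReal.ofReal r ^ (s - 1)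
      ≤ ∫⁻ r in Ioc 0 x, ENNReal.ofReal x ^ (s - 1) :=
        setLIntegral_mono' measurableSet_Ioc fun r hr =>
          ENNReal.rpow_le_rpow (ENNReal.ofReal_le_ofReal hr.2) (by linarith)
    _ = ENNReal.ofReal x ^ (s - 1) * ENNReal.ofReal x := by simp
    _ = _ := by
        conv_rhs => rw [show s = (s - 1) + 1 by ring]
        rw [ENNReal.rpow_add_of_nonneg _ _ (by linarith) zero_le_one, ENNReal.rpow_one]

/-- After Tonelli, the weight t^(-s) w(t) is multiplied by the integral of r^(s-1) over (0,
min(x,t)]. For t ≤ x this leaves at most w(t), whence the 1; for t > x it leaves at most (x/t)^s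
w(t), whose integral the B_s condition bounds, whence the K. -/
theorem lintegral_Ioc_rpow_mul_tail_le {s : ℝ} (hs : 1 < s) {K : ℝ≥0} {w : ℝ → ℝ≥0}
    (hw : Measurable w)
    (hB : ∀ r : ℝ, 0 < r → ∫⁻ t in Ioi r, ENNReal.ofReal ((r / t) ^ s) * (w t : ℝ≥0∞) ≤
        (K : ℝ≥0∞) * ∫⁻ t in Ioc (0 : ℝ) r, (w t : ℝ≥0∞)) (x : ℝ) (hx : 0 < x) :
    ∫⁻ r in Ioc 0 x, ENNReal.ofReal r ^ (s - 1) *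
        ∫⁻ t in Ici r, ENNReal.ofReal t ^ (-s) * (w t : ℝ≥0∞) ≤
      (1 + K : ℝ≥0) * ∫⁻ t in Ioc 0 x, (w t : ℝ≥0∞) := by
  set κ : ℝ → ℝ≥0∞ := fun t => ENNReal.ofReal t ^ (-s) * (w t : ℝ≥0∞) with hκ
  have hκm : Measurable κ := by fun_prop
  set Ψ : ℝ → ℝ≥0∞ := (Iic x).indicator fun r => ENNReal.ofReal r ^ (s - 1) with hΨ
  have hΨm : Measurable Ψ := Measurable.indicator (by fun_prop) measurableSet_Iic
  have e1 : ∫⁻ r in Ioc 0 x, ENNReal.ofReal r ^ (s - 1) * ∫⁻ t in Ici r, κ t =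
      ∫⁻ r in Ioi (0 : ℝ), Ψ r * ∫⁻ t in Ici r, κ t := by
    rw [← Iic_inter_Ioi, ← Measure.restrict_restrict measurableSet_Iic,
      ← lintegral_indicator measurableSet_Iic]
    refine lintegral_congr fun r => ?_
    simp only [hΨ, indicator]
    split_ifs <;> simp
  have hin1 : ∀ t, ∫⁻ r in Ioc 0 t, Ψ r ≤ ENNReal.ofReal t ^ s := fun t =>
    (lintegral_mono (indicator_le_self _ _)).trans (lintegral_Ioc_rpow_le hs t)
  have hin2 : ∀ t, ∫⁻ r in Ioc 0 t, Ψ r ≤ ENNReal.ofReal x ^ s := fun t => by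
    refine le_trans ?_ (lintegral_Ioc_rpow_le hs x)
    rw [hΨ, lintegral_indicator measurableSet_Iic, Measure.restrict_restrict measurableSet_Iic]
    refine lintegral_mono_set ?_
    rintro r ⟨h1, h2⟩
    exact ⟨h2.1, h1⟩
  rw [e1, ← lintegral_triangle_swap hκm hΨm, ← Ioc_union_Ioi_eq_Ioi hx.le]
  refine (lintegral_union_le _ _ _).trans ?_
  rw [ENNReal.coe_add, ENNReal.coe_one, add_mul, one_mul]
  refine add_le_add ?_ (le_trans ?_ (hB x hx))
  · refine setLIntegral_mono' measurableSet_Ioc fun t ht => ?_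
    refine (mul_le_mul_right (hin1 t) _).trans ?_
    have h0 : ENNReal.ofReal t ≠ 0 := by simp [ht.1]
    rw [hκ, mul_right_comm, ← ENNReal.rpow_add _ _ h0 (by simp)]
    simp
  · refine setLIntegral_mono' measurableSet_Ioi fun t ht => ?_
    refine (mul_le_mul_right (hin2 t) _).trans ?_
    have ht0 : 0 < t := hx.trans ht
    rw [hκ, mul_right_comm, ← ENNReal.ofReal_rpow_of_nonneg (by positivity) (by linarith),
      ENNReal.ofReal_div_of_pos ht0, ENNReal.div_rpow_of_nonneg _ _ (by linarith),
      ENNReal.rpow_neg, mul_comm (_)⁻¹, ENNReal.div_eq_inv_mul, mul_comm (_)⁻¹]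

/-- With I and J the two integrals, the aim is I ≤ D I^((s-1)/s) J^(1/s), from which a power of I is
cancelled. The boundedness of h and the finite mass of w make I finite, as the cancellation
requires. -/
theorem hardy_bounded {h : ℝ → ℝ≥0∞} (hh : Antitone h) {N : ℝ≥0} (hN : ∀ t, h t ≤ N)
    {s : ℝ} (hs : 1 < s) {K : ℝ≥0} {w : ℝ → ℝ≥0} (hw : Measurable w)
    (hB : ∀ r : ℝ, 0 < r → ∫⁻ t in Ioi r, ENNReal.ofReal ((r / t) ^ s) * (w t : ℝ≥0∞) ≤
        (K : ℝ≥0∞) * ∫⁻ t in Ioc (0 : ℝ) r, (w t : ℝ≥0∞))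
    (hfin : ∫⁻ t in Ioi (0 : ℝ), (w t : ℝ≥0∞) ≠ ⊤) :
    ∫⁻ t in Ioi (0 : ℝ), lowerMean h t ^ s * (w t : ℝ≥0∞) ≤
      (2 ^ s * (1 + K : ℝ≥0)) ^ s * ∫⁻ t in Ioi (0 : ℝ), h t ^ s * (w t : ℝ≥0∞) := by
  have hm : Measurable h := hh.measurable
  have hAm := measurable_lowerMean h
  set I := ∫⁻ t in Ioi (0 : ℝ), lowerMean h t ^ s * (w t : ℝ≥0∞) with hI
  set J := ∫⁻ t in Ioi (0 : ℝ), h t ^ s * (w t : ℝ≥0∞) with hJ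
  set D : ℝ≥0∞ := 2 ^ s * (1 + K : ℝ≥0) with hD
  have hs0 : 0 < s := by linarith
  have hs1 : 0 < s - 1 := by linarith
  set κ : ℝ → ℝ≥0∞ := fun t => ENNReal.ofReal t ^ (-s) * (w t : ℝ≥0∞) with hκ
  have hκm : Measurable κ := by fun_prop
  set P : ℝ → ℝ≥0∞ := fun r => ∫⁻ u in Ioc 0 r, h u with hP
  have hPm : Measurable P := measurable_primitive h
  set φ : ℝ → ℝ≥0∞ := fun r => ENNReal.ofReal r ^ (s - 1) * ∫⁻ t in Ici r, κ t with hφ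
  have hφm : Measurable φ := by
    have : Measurable fun r => ∫⁻ t in Ici r, κ t :=
      Antitone.measurable fun a b hab => lintegral_mono_set (Ici_subset_Ici.2 hab)
    fun_prop
  have step1 : I ≤ 2 ^ s * ∫⁻ r in Ioi (0 : ℝ), (lowerMean h r ^ (s - 1) * h r) * φ r := by
    calc I ≤ ∫⁻ t in Ioi (0 : ℝ), 2 ^ s * (κ t * ∫⁻ r in Ioc 0 t, P r ^ (s - 1) * h r) := by
          refine setLIntegral_mono' measurableSet_Ioi fun t ht => ?_
          have := rpow_lintegral_le hm hN hs t ht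
          calc lowerMean h t ^ s * (w t : ℝ≥0∞) = P t ^ s * κ t := by
                simp only [lowerMean, hκ, hP]
                rw [ENNReal.div_rpow_of_nonneg _ _ hs0.le, ENNReal.rpow_neg,
                  div_eq_mul_inv, mul_assoc]
            _ ≤ _ := mul_le_mul_left this _
            _ = _ := by ring
      _ = 2 ^ s * ∫⁻ t in Ioi (0 : ℝ), κ t * ∫⁻ r in Ioc 0 t, P r ^ (s - 1) * h r :=
          lintegral_const_mul' _ _ (by finiteness)
      _ = 2 ^ s * ∫⁻ r in Ioi (0 : ℝ), P r ^ (s - 1) * h r * ∫⁻ t in Ici r, κ t := by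
          rw [lintegral_triangle_swap hκm (by fun_prop)]
      _ = _ := by
          congr 1
          refine setLIntegral_congr_fun measurableSet_Ioi fun r hr => ?_
          have hPr : P r = lowerMean h r * ENNReal.ofReal r := by
            rw [lowerMean, ENNReal.div_mul_cancel (by simpa using hr) (by simp)]
          simp only [hφ, hPr, ENNReal.mul_rpow_of_nonneg _ _ hs1.le]
          ring
  -- The factor multiplying φ is non-increasing, so φ may be replaced by (1+K) w, whose primitive
  -- dominates that of φ.
  have step2 : ∫⁻ r in Ioi (0 : ℝ), (lowerMean h r ^ (s - 1) * h r) * φ r ≤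
      (1 + K : ℝ≥0) * ∫⁻ r in Ioi (0 : ℝ), (lowerMean h r ^ (s - 1) * h r) * (w r : ℝ≥0∞) := by
    refine lintegral_antitone_mul_le hφm (by fun_prop) ?_
      (lintegral_Ioc_rpow_mul_tail_le hs hw hB)
    intro a ha b hb hab
    have h1 := lowerMean_antitoneOn hh ha hb hab
    have h2 := hh hab
    show lowerMean h b ^ (s - 1) * h b ≤ lowerMean h a ^ (s - 1) * h a
    gcongr
  have hconj : (s / (s - 1)).HolderConjugate s := (Real.HolderConjugate.conjExponent hs).symm
  have step3 : ∫⁻ r in Ioi (0 : ℝ), (lowerMean h r ^ (s - 1) * h r) * (w r : ℝ≥0∞) ≤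
      I ^ ((s - 1) / s) * J ^ (1 / s) := by
    set ν := (volume.restrict (Ioi (0 : ℝ))).withDensity fun t => (w t : ℝ≥0∞) with hν
    have hwm : Measurable fun t => (w t : ℝ≥0∞) := by fun_prop
    have conv : ∀ g : ℝ → ℝ≥0∞, Measurable g →
        ∫⁻ t, g t ∂ν = ∫⁻ t in Ioi (0 : ℝ), g t * (w t : ℝ≥0∞) := fun g hg => by
      rw [hν, lintegral_withDensity_eq_lintegral_mul _ hwm hg]
      exact lintegral_congr fun t => by simp [mul_comm]
    have := ENNReal.lintegral_mul_le_Lp_mul_Lq ν hconj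
      (f := fun t => lowerMean h t ^ (s - 1)) (g := h) (by fun_prop) (by fun_prop)
    simp only [Pi.mul_apply, ← ENNReal.rpow_mul] at this
    rw [mul_div_cancel₀ _ hs1.ne', conv _ (by fun_prop), conv _ (by fun_prop),
      conv _ (by fun_prop), one_div_div] at this
    exact this
  have hfinI : I ≠ ⊤ := by
    refine ne_top_of_le_ne_top (b := (N : ℝ≥0∞) ^ s * ∫⁻ t in Ioi (0 : ℝ), (w t : ℝ≥0∞))
      (by finiteness) ?_
    rw [← lintegral_const_mul' _ _ (by finiteness)]
    refine setLIntegral_mono' measurableSet_Ioi fun t ht => ?_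
    gcongr
    rw [lowerMean, ENNReal.div_le_iff_le_mul (by simp_all) (by simp)]
    calc _ ≤ ∫⁻ r in Ioc 0 t, (N : ℝ≥0∞) := lintegral_mono hN
      _ = _ := by simp
  rcases eq_or_ne I 0 with hI0 | hI0
  · rw [hI0]; exact zero_le
  have step4 : I ≤ D * (I ^ ((s - 1) / s) * J ^ (1 / s)) := by
    rw [hD, mul_assoc]
    exact step1.trans (by gcongr; exact step2.trans (by gcongr))
  have step5 : I ^ (1 / s) ≤ D * J ^ (1 / s) := by
    have e : I = I ^ ((s - 1) / s) * I ^ (1 / s) := by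
      rw [← ENNReal.rpow_add _ _ hI0 hfinI, ← add_div, sub_add_cancel, div_self hs0.ne',
        ENNReal.rpow_one]
    rw [mul_left_comm] at step4
    nth_rewrite 1 [e] at step4
    refine (ENNReal.mul_le_mul_iff_right ?_ ?_).1 step4
    · simp [ENNReal.rpow_eq_zero_iff, hI0, hfinI]
    · simp [ENNReal.rpow_eq_top_iff, hI0, hfinI]
  calc I = (I ^ (1 / s)) ^ s := by
        rw [← ENNReal.rpow_mul, one_div_mul_cancel hs0.ne', ENNReal.rpow_one]
    _ ≤ (D * J ^ (1 / s)) ^ s := by gcongr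
    _ = _ := by
        rw [ENNReal.mul_rpow_of_nonneg _ _ hs0.le, ← ENNReal.rpow_mul,
          one_div_mul_cancel hs0.ne', ENNReal.rpow_one]

/-- Were the mass of (0,r] finite, the B_s condition at r would bound the mass of (r,N] too.
Infinite mass of some (0,N] is therefore concentrated at the origin. -/
theorem lintegral_weight_Ioc_eq_top {s : ℝ} (hs : 0 < s) {K : ℝ≥0} {w : ℝ → ℝ≥0}
    (hB : ∀ r : ℝ, 0 < r → ∫⁻ t in Ioi r, ENNReal.ofReal ((r / t) ^ s) * (w t : ℝ≥0∞) ≤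
        (K : ℝ≥0∞) * ∫⁻ t in Ioc (0 : ℝ) r, (w t : ℝ≥0∞)) {N : ℝ}
    (hN : ∫⁻ t in Ioc 0 N, (w t : ℝ≥0∞) = ⊤) {r : ℝ} (hr : 0 < r) :
    ∫⁻ t in Ioc 0 r, (w t : ℝ≥0∞) = ⊤ := by
  by_contra hne
  rcases le_or_gt N r with h | h
  · exact hne (top_unique (hN.symm.le.trans (lintegral_mono_set (Ioc_subset_Ioc_right h))))
  have hN0 : 0 < N := hr.trans h
  have h1 : ∫⁻ t in Ioc r N, (w t : ℝ≥0∞) ≤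
      ENNReal.ofReal ((N / r) ^ s) * ((K : ℝ≥0∞) * ∫⁻ t in Ioc (0 : ℝ) r, (w t : ℝ≥0∞)) := by
    calc ∫⁻ t in Ioc r N, (w t : ℝ≥0∞)
        ≤ ∫⁻ t in Ioc r N, ENNReal.ofReal ((N / r) ^ s) *
            (ENNReal.ofReal ((r / t) ^ s) * (w t : ℝ≥0∞)) := by
          refine setLIntegral_mono' measurableSet_Ioc fun t ht => ?_
          have ht0 : 0 < t := hr.trans ht.1
          rw [← mul_assoc, ← ENNReal.ofReal_mul (by positivity),
            ← Real.mul_rpow (by positivity) (by positivity)]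
          refine le_mul_of_one_le_left' ?_
          rw [ENNReal.one_le_ofReal]
          refine Real.one_le_rpow ?_ hs.le
          rw [div_mul_div_cancel₀ hr.ne', one_le_div ht0]
          exact ht.2
      _ = ENNReal.ofReal ((N / r) ^ s) *
            ∫⁻ t in Ioc r N, ENNReal.ofReal ((r / t) ^ s) * (w t : ℝ≥0∞) :=
          lintegral_const_mul' _ _ ENNReal.ofReal_ne_top
      _ ≤ _ := by
          gcongr
          exact (lintegral_mono_set Ioc_subset_Ioi_self).trans (hB r hr)
  have h2 : ∫⁻ t in Ioc 0 N, (w t : ℝ≥0∞) ≤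
      (∫⁻ t in Ioc 0 r, (w t : ℝ≥0∞)) + ∫⁻ t in Ioc r N, (w t : ℝ≥0∞) :=
    (lintegral_mono_set Ioc_subset_Ioc_union_Ioc).trans (lintegral_union_le _ _ _)
  rw [hN] at h2
  have h3 := h2.trans (add_le_add le_rfl h1)
  refine absurd (top_unique h3) ?_
  finiteness

theorem hardy_of_measurable {h : ℝ → ℝ≥0∞} (hh : Antitone h)
    {s : ℝ} (hs : 1 < s) {K : ℝ≥0} {w : ℝ → ℝ≥0} (hw : Measurable w)
    (hB : ∀ r : ℝ, 0 < r → ∫⁻ t in Ioi r, ENNReal.ofReal ((r / t) ^ s) * (w t : ℝ≥0∞) ≤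
        (K : ℝ≥0∞) * ∫⁻ t in Ioc (0 : ℝ) r, (w t : ℝ≥0∞)) :
    ∫⁻ t in Ioi (0 : ℝ), lowerMean h t ^ s * (w t : ℝ≥0∞) ≤
      (2 ^ s * (1 + K : ℝ≥0)) ^ s * ∫⁻ t in Ioi (0 : ℝ), h t ^ s * (w t : ℝ≥0∞) := by
  have hs0 : 0 < s := by linarith
  set J := ∫⁻ t in Ioi (0 : ℝ), h t ^ s * (w t : ℝ≥0∞) with hJ
  rcases eq_or_ne J ⊤ with hJt | hJt
  · rw [hJt, ENNReal.mul_top]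
    · exact le_top
    · simp [ENNReal.rpow_eq_zero_iff, not_lt.2 hs0.le]
  by_cases hW : ∃ N : ℝ, ∫⁻ t in Ioc 0 N, (w t : ℝ≥0∞) = ⊤
  · obtain ⟨N, hN⟩ := hW
    -- When w is not integrable at the origin, a non-increasing h with J finite must vanish on the
    -- half-line.
    have h0 : ∀ t, 0 < t → h t = 0 := by
      intro t ht
      by_contra hne
      refine hJt (top_unique ?_)
      calc (⊤ : ℝ≥0∞) = h t ^ s * ∫⁻ r in Ioc 0 t, (w r : ℝ≥0∞) := by
            rw [lintegral_weight_Ioc_eq_top hs0 hB hN ht, ENNReal.mul_top]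
            simp [ENNReal.rpow_eq_zero_iff, hne, hs0.le]
        _ ≤ ∫⁻ r in Ioc 0 t, h t ^ s * (w r : ℝ≥0∞) := lintegral_const_mul_le _ _
        _ ≤ ∫⁻ r in Ioc 0 t, h r ^ s * (w r : ℝ≥0∞) := by
            refine setLIntegral_mono' measurableSet_Ioc fun r hr => ?_
            have := hh hr.2
            gcongr
        _ ≤ J := lintegral_mono_set Ioc_subset_Ioi_self
    have hz : ∫⁻ t in Ioi (0 : ℝ), lowerMean h t ^ s * (w t : ℝ≥0∞) = 0 := by
      rw [setLIntegral_congr_fun (g := fun _ => 0) measurableSet_Ioi fun t _ => ?_]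
      · simp
      · have : ∫⁻ r in Ioc 0 t, h r = 0 := by
          rw [setLIntegral_congr_fun (g := fun _ => 0) measurableSet_Ioc fun r hr => h0 r hr.1]
          simp
        simp [lowerMean, this, hs0]
    rw [hz]; exact zero_le
  push Not at hW
  -- Truncate h in height and w in range. The cut weight keeps the constant K: for r < N the
  -- right-hand side of the condition is unchanged, and for r ≥ N the left-hand side vanishes.
  -- Monotone convergence then removes the truncation.
  set hN : ℕ → ℝ → ℝ≥0∞ := fun N t => min (h t) N with hhN
  set wN : ℕ → ℝ → ℝ≥0 := fun N => (Iic (N : ℝ)).indicator w with hwN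
  have hwm : ∀ N, Measurable (wN N) := fun N => hw.indicator measurableSet_Iic
  have hwle : ∀ N t, wN N t ≤ w t := fun N t => indicator_le_self _ _ _
  have hNa : ∀ N, Antitone (hN N) := fun N a b hab => min_le_min_right _ (hh hab)
  have bound : ∀ N : ℕ, ∫⁻ t in Ioi (0 : ℝ), lowerMean (hN N) t ^ s * (wN N t : ℝ≥0∞) ≤
      (2 ^ s * (1 + K : ℝ≥0)) ^ s * J := by
    intro N
    refine (hardy_bounded (hNa N) (N := N) (fun t => ?_) hs (K := K) (hwm N) (fun r hr => ?_)
      ?_).trans ?_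
    · exact (min_le_right _ _).trans (by simp)
    · rcases lt_or_ge r N with h | h
      · have e : ∫⁻ t in Ioc (0 : ℝ) r, (wN N t : ℝ≥0∞) = ∫⁻ t in Ioc (0 : ℝ) r, (w t : ℝ≥0∞) := by
          refine setLIntegral_congr_fun measurableSet_Ioc fun t ht => ?_
          have : t ∈ Iic (N : ℝ) := ht.2.trans h.le
          simp only [hwN, indicator_of_mem this]
        rw [e]
        refine le_trans (lintegral_mono fun t => ?_) (hB r hr)
        gcongr
        exact hwle N t
      · rw [setLIntegral_congr_fun (g := fun _ => 0) measurableSet_Ioi fun t ht => ?_]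
        · simp
        · have : t ∉ Iic (N : ℝ) := not_le.2 (lt_of_le_of_lt h ht)
          simp only [hwN, indicator_of_notMem this, ENNReal.coe_zero, mul_zero]
    · refine ne_top_of_le_ne_top (hW N) ?_
      rw [← Iic_inter_Ioi, ← Measure.restrict_restrict measurableSet_Iic,
        ← lintegral_indicator measurableSet_Iic]
      refine lintegral_mono fun t => ?_
      simp only [hwN, indicator]
      split_ifs <;> simp
    · gcongr
      refine lintegral_mono fun t => ?_
      have := hwle N t
      gcongr
      exact min_le_left _ _
  refine le_of_tendsto' (lintegral_tendsto_of_tendsto_of_monotone (fun N => ?_)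
    (Eventually.of_forall fun t => ?_) (ae_restrict_of_forall_mem measurableSet_Ioi
      fun t ht => ?_)) bound
  · have := measurable_lowerMean (hN N)
    have := hwm N
    fun_prop
  · intro i j hij
    have hij' : (i : ℝ) ≤ j := by exact_mod_cast hij
    have h1 : lowerMean (hN i) t ≤ lowerMean (hN j) t := by
      refine ENNReal.div_le_div_right (lintegral_mono fun r => min_le_min_left _ ?_) _
      exact_mod_cast hij
    have h2 : wN i t ≤ wN j t :=
      indicator_le_indicator_of_subset (Iic_subset_Iic.2 hij') (fun _ => zero_le) _
    show lowerMean (hN i) t ^ s * (wN i t : ℝ≥0∞) ≤ lowerMean (hN j) t ^ s * (wN j t : ℝ≥0∞)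
    gcongr
  · have h1 : Tendsto (fun N => lowerMean (hN N) t) atTop (𝓝 (lowerMean h t)) := by
      refine ENNReal.Tendsto.div_const ?_ ?_
      · refine lintegral_tendsto_of_tendsto_of_monotone
          (fun N => (hNa N).measurable.aemeasurable) (Eventually.of_forall fun r i j hij => ?_)
          (Eventually.of_forall fun r => ?_)
        · exact min_le_min_left _ (by exact_mod_cast hij)
        · have := (tendsto_const_nhds (x := h r) (f := atTop)).min ENNReal.tendsto_nat_nhds_top
          simpa using this
      · right; simpa using ht
    have h2 := ((ENNReal.continuous_rpow_const (y := s)).tendsto _).comp h1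
    have h3 := ENNReal.Tendsto.mul_const h2 (b := (w t : ℝ≥0∞)) (Or.inr ENNReal.coe_ne_top)
    refine h3.congr' ?_
    filter_upwards [eventually_ge_atTop ⌈t⌉₊] with N hNt
    have : t ∈ Iic (N : ℝ) := Nat.ceil_le.1 hNt
    simp only [hwN, indicator_of_mem this, Function.comp]

theorem hardy_of_isBpWeight {h : ℝ → ℝ≥0∞} (hh : Antitone h)
    {s : ℝ} (hs : 1 < s) {K : ℝ≥0} {w : ℝ → ℝ≥0} (hw : IsBpWeight s K w) :
    ∫⁻ t in Ioi (0 : ℝ), lowerMean h t ^ s * (w t : ℝ≥0∞) ≤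
      (2 ^ s * (1 + K : ℝ≥0)) ^ s * ∫⁻ t in Ioi (0 : ℝ), h t ^ s * (w t : ℝ≥0∞) := by
  obtain ⟨hm, hB⟩ := hw
  set w' : ℝ → ℝ≥0 := AEMeasurable.mk w hm with hw'
  have hww : w =ᵐ[volume.restrict (Ioi 0)] w' := hm.ae_eq_mk
  have key : ∀ (D : Set ℝ) (u : ℝ → ℝ≥0∞), D ⊆ Ioi 0 →
      ∫⁻ t in D, u t * (w' t : ℝ≥0∞) = ∫⁻ t in D, u t * (w t : ℝ≥0∞) := by
    intro D u hD
    refine lintegral_congr_ae ?_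
    filter_upwards [ae_mono (Measure.restrict_mono hD le_rfl) hww] with t ht
    rw [ht]
  rw [← key _ _ subset_rfl, ← key _ _ subset_rfl]
  refine hardy_of_measurable hh hs hm.measurable_mk fun r hr => ?_
  have h1 := key (Ioi r) (fun t => ENNReal.ofReal ((r / t) ^ s)) (Ioi_subset_Ioi hr.le)
  have h2 := key (Ioc 0 r) (fun t => 1) Ioc_subset_Ioi_self
  simp only [one_mul] at h2
  rw [h1, h2]
  exact hB r hr

/-! ### The maximal function and its rearrangement. -/

/-- The centred Hardy–Littlewood maximal function. -/
noncomputable def hlMax {n : ℕ} (G : Eucl n → ℝ≥0∞) (x : Eucl n) : ℝ≥0∞ :=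
  ⨆ (r : ℝ) (_ : 0 < r), (∫⁻ y in Metric.ball x r, G y) / volume (Metric.ball x r)

theorem volume_ball_mul {n : ℕ} (x y : Eucl n) {c r : ℝ} (hc : 0 < c) :
    volume (Metric.ball x (c * r)) = ENNReal.ofReal c ^ n * volume (Metric.ball y r) := by
  rw [Measure.addHaar_ball_mul_of_pos _ _ hc, Measure.addHaar_ball_center _ y,
    finrank_euclideanSpace, Fintype.card_fin, ENNReal.ofReal_pow hc.le]

theorem volume_ball_ne_zero {n : ℕ} (x : Eucl n) {r : ℝ} (hr : 0 < r) :
    volume (Metric.ball x r) ≠ 0 := (Metric.measure_ball_pos _ _ hr).ne'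

theorem volume_ball_ne_top {n : ℕ} (x : Eucl n) {r : ℝ} :
    volume (Metric.ball x r) ≠ ⊤ := measure_ball_lt_top.ne

theorem lintegral_ball_le_hlMax {n : ℕ} (G : Eucl n → ℝ≥0∞) (x : Eucl n) {r : ℝ} (hr : 0 < r) :
    ∫⁻ y in Metric.ball x r, G y ≤ hlMax G x * volume (Metric.ball x r) := by
  rw [← ENNReal.div_le_iff_le_mul (Or.inl (volume_ball_ne_zero x hr))
    (Or.inl (volume_ball_ne_top x))]
  exact le_iSup₂ (f := fun (r : ℝ) (_ : 0 < r) =>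
    (∫⁻ y in Metric.ball x r, G y) / volume (Metric.ball x r)) r hr

theorem hlMax_le_iff {n : ℕ} {G : Eucl n → ℝ≥0∞} {x : Eucl n} {c : ℝ≥0∞} :
    hlMax G x ≤ c ↔ ∀ r, 0 < r →
      ∫⁻ y in Metric.ball x r, G y ≤ c * volume (Metric.ball x r) := by
  simp only [hlMax, iSup_le_iff]
  refine forall₂_congr fun r hr => ?_
  rw [ENNReal.div_le_iff_le_mul (Or.inl (volume_ball_ne_zero x hr))
    (Or.inl (volume_ball_ne_top x))]

/-- The weak type `(1, 1)` bound of the maximal function. -/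
theorem mul_volume_hlMax_le {n : ℕ} (hn : n ≠ 0) (G : Eucl n → ℝ≥0∞) (l : ℝ≥0∞) :
    l * volume {x | l < hlMax G x} ≤ 4 ^ n * ∫⁻ y, G y := by
  set I := ∫⁻ y, G y with hI
  rcases eq_or_ne I ⊤ with hIt | hIt
  · rw [hIt, ENNReal.mul_top (by simp)]; exact le_top
  rcases eq_or_ne l 0 with rfl | hl0
  · simp
  rcases eq_or_ne l ⊤ with rfl | hlt
  · simp
  set A := {x | l < hlMax G x} with hA
  have hex : ∀ x ∈ A, ∃ r, 0 < r ∧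
      l * volume (Metric.ball x r) < ∫⁻ y in Metric.ball x r, G y := by
    intro x hx
    by_contra! hcon
    exact absurd (hlMax_le_iff.2 hcon) (not_le.2 hx)
  choose! r hr0 hr using hex
  set v := volume (Metric.ball (0 : Eucl n) 1) with hv
  have hv0 : v ≠ 0 := volume_ball_ne_zero _ one_pos
  have hvt : v ≠ ⊤ := volume_ball_ne_top _
  -- The Vitali covering needs bounded radii. A selected ball satisfies l v r^n ≤ I, and r ≤ r^n
  -- once r ≥ 1.
  set R := max 1 (I / l / v).toReal with hR
  have hrR : ∀ x ∈ A, r x ≤ R := by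
    intro x hx
    rcases le_or_gt (r x) 1 with h1 | h1
    · exact h1.trans (le_max_left _ _)
    have h2 : l * (ENNReal.ofReal (r x) ^ n * v) ≤ I := by
      rw [hv, ← volume_ball_mul x 0 (hr0 x hx), mul_one]
      exact (hr x hx).le.trans (setLIntegral_le_lintegral _ _)
    have h3 : ENNReal.ofReal (r x ^ n) ≤ I / l / v := by
      rw [ENNReal.ofReal_pow (hr0 x hx).le, ENNReal.le_div_iff_mul_le (Or.inl hv0) (Or.inl hvt),
        ENNReal.le_div_iff_mul_le (Or.inl hl0) (Or.inl hlt), mul_comm]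
      exact h2
    have h4 : r x ^ n ≤ (I / l / v).toReal :=
      (ENNReal.ofReal_le_iff_le_toReal (by finiteness)).1 h3
    exact (le_self_pow₀ h1.le hn).trans (h4.trans (le_max_right _ _))
  obtain ⟨u, huA, hdisj, hcov⟩ := Vitali.exists_disjoint_subfamily_covering_enlargement_ball
    A id r R hrR 4 (by norm_num)
  have hucount : u.Countable := hdisj.countable_of_isOpen (fun _ _ => Metric.isOpen_ball)
    fun a ha => ⟨a, Metric.mem_ball_self (hr0 a (huA ha))⟩
  have hsub : A ⊆ ⋃ b ∈ u, Metric.ball b (4 * r b) := by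
    intro x hx
    obtain ⟨b, hb, hxb⟩ := hcov x hx
    exact mem_iUnion₂.2 ⟨b, hb, hxb (Metric.mem_ball_self (hr0 x hx))⟩
  have : Countable u := hucount
  calc l * volume A ≤ l * ∑' b : u, volume (Metric.ball (b : Eucl n) (4 * r b)) := by
        gcongr
        exact (measure_mono hsub).trans (measure_biUnion_le _ hucount _)
    _ = 4 ^ n * ∑' b : u, l * volume (Metric.ball (b : Eucl n) (r b)) := by
        rw [← ENNReal.tsum_mul_left, ← ENNReal.tsum_mul_left]
        refine tsum_congr fun b => ?_
        rw [volume_ball_mul _ (b : Eucl n) (by norm_num : (0 : ℝ) < 4)]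
        simp only [ENNReal.ofReal_ofNat]
        ring
    _ ≤ 4 ^ n * ∑' b : u, ∫⁻ y in Metric.ball (b : Eucl n) (r b), G y := by
        gcongr with b
        exact (hr b (huA b.2)).le
    _ = 4 ^ n * ∫⁻ y in ⋃ b ∈ u, Metric.ball b (r b), G y := by
        congr 1
        exact (lintegral_biUnion hucount (fun _ _ => Metric.isOpen_ball.measurableSet)
          hdisj G).symm
    _ ≤ _ := by gcongr; exact setLIntegral_le_lintegral _ _

theorem hlMax_le_sub_add {n : ℕ} (G : Eucl n → ℝ≥0∞) (c : ℝ≥0∞) (x : Eucl n) :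
    hlMax G x ≤ hlMax (fun y => G y - c) x + c := by
  rw [hlMax_le_iff]
  intro r hr
  calc ∫⁻ y in Metric.ball x r, G y ≤ ∫⁻ y in Metric.ball x r, ((G y - c) + c) :=
        lintegral_mono fun y => le_tsub_add
    _ = (∫⁻ y in Metric.ball x r, (G y - c)) + c * volume (Metric.ball x r) := by
        rw [lintegral_add_right _ measurable_const, setLIntegral_const]
    _ ≤ _ := by
        rw [add_mul]
        gcongr
        exact lintegral_ball_le_hlMax _ x hr

/-- Cut G at height c = G^*(t). The part below c adds at most c to the maximal function, and the
excess has integral at most that of G^* over (0,t], so the weak (1,1) bound applies to it at level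
l. -/
theorem decRearr_hlMax_le {n : ℕ} (hn : n ≠ 0) {G : Eucl n → ℝ≥0∞} (hG : AEMeasurable G)
    {t : ℝ} (ht : 0 < t) :
    decRearr volume (hlMax G) t ≤ (4 ^ n + 1) * lowerMean (decRearr volume G) t := by
  set c := decRearr volume G t with hc
  set l := 4 ^ n * lowerMean (decRearr volume G) t with hl
  have hcl : c ≤ lowerMean (decRearr volume G) t := le_lowerMean (decRearr_antitone _ _) ht
  suffices h : decRearr volume (hlMax G) t ≤ l + c by
    refine h.trans ?_
    rw [add_mul, one_mul]
    gcongr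
  rw [decRearr_le_iff]
  have hsub : {x | l + c < hlMax G x} ⊆ {x | l < hlMax (fun y => G y - c) x} := by
    intro x hx
    have hx : l + c < hlMax G x := hx
    exact lt_of_add_lt_add_right (hx.trans_le (hlMax_le_sub_add G c x))
  refine (measure_mono hsub).trans ?_
  have hI : ∫⁻ y, (G y - c) ≤ ∫⁻ r in Ioc 0 t, decRearr volume G r :=
    lintegral_sub_decRearr_le volume hG
  have hlt : 4 ^ n * ∫⁻ r in Ioc 0 t, decRearr volume G r = l * ENNReal.ofReal t := by
    rw [hl, mul_assoc, lowerMean, ENNReal.div_mul_cancel (by simp [ht]) (by simp)]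
  rcases eq_or_ne l ⊤ with h1 | h1
  · simp [h1]
  -- At level zero the weak type bound says nothing, but then the excess has zero integral and its
  -- maximal function vanishes.
  rcases eq_or_ne l 0 with h0 | h0
  · have hI0 : ∫⁻ y, (G y - c) = 0 := by
      rw [h0, zero_mul] at hlt
      have : ∫⁻ r in Ioc 0 t, decRearr volume G r = 0 := by simpa using hlt
      exact le_antisymm (hI.trans this.le) zero_le
    have : {x | l < hlMax (fun y => G y - c) x} = ∅ := by
      refine eq_empty_of_forall_notMem fun x hx => ?_
      refine absurd (show l < hlMax (fun y => G y - c) x from hx) (not_lt.2 ?_)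
      refine le_trans (hlMax_le_iff.2 fun r _ => ?_) zero_le
      rw [zero_mul, ← hI0]
      exact setLIntegral_le_lintegral _ _
    rw [this]; simp
  · have := (mul_volume_hlMax_le hn (fun y => G y - c) l).trans
      ((mul_le_mul_right hI _).trans hlt.le)
    exact (ENNReal.mul_le_mul_iff_right h0 h1).1 this

theorem lintegral_decRearr_hlMax_le {n : ℕ} (hn : n ≠ 0) {G : Eucl n → ℝ≥0∞}
    (hG : AEMeasurable G) {s : ℝ} (hs : 1 < s) {K : ℝ≥0} {w : ℝ → ℝ≥0} (hw : IsBpWeight s K w) :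
    ∫⁻ t in Ioi (0 : ℝ), decRearr volume (hlMax G) t ^ s * (w t : ℝ≥0∞) ≤
      ((4 ^ n + 1) * (2 ^ s * (1 + K : ℝ≥0))) ^ s *
        ∫⁻ t in Ioi (0 : ℝ), decRearr volume G t ^ s * (w t : ℝ≥0∞) := by
  have hs0 : 0 ≤ s := by linarith
  rw [ENNReal.mul_rpow_of_nonneg _ _ hs0, mul_assoc]
  refine le_trans ?_ (mul_le_mul_right (hardy_of_isBpWeight (decRearr_antitone volume G) hs hw) _)
  rw [← lintegral_const_mul' _ _ (by finiteness)]
  refine setLIntegral_mono' measurableSet_Ioi fun t ht => ?_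
  rw [← mul_assoc, ← ENNReal.mul_rpow_of_nonneg _ _ hs0]
  gcongr
  exact decRearr_hlMax_le hn hG ht

/-- For centres in a fixed ball, radii below 1 only see the restriction of G to a slightly larger
ball, which is integrable and so has an almost everywhere finite maximal function. Radii at least 1
contribute at most N. -/
theorem hlMax_ae_lt_top {n : ℕ} (hn : n ≠ 0) {G : Eucl n → ℝ≥0∞} {N : ℝ≥0∞} (hN : N ≠ ⊤)
    (hloc : ∀ r, ∫⁻ y in Metric.ball 0 r, G y ≠ ⊤)
    (hlarge : ∀ x r, 1 ≤ r → ∫⁻ y in Metric.ball x r, G y ≤ N * volume (Metric.ball x r)) :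
    ∀ᵐ x, hlMax G x < ⊤ := by
  have hk : ∀ k : ℕ, ∀ᵐ x, x ∈ Metric.ball (0 : Eucl n) k → hlMax G x < ⊤ := by
    intro k
    set G' := (Metric.ball (0 : Eucl n) (k + 1)).indicator G with hG'
    have hI : ∫⁻ y, G' y ≠ ⊤ := by
      rw [hG', lintegral_indicator Metric.isOpen_ball.measurableSet]
      exact hloc _
    have hle : ∀ x ∈ Metric.ball (0 : Eucl n) k, hlMax G x ≤ hlMax G' x + N := by
      intro x hx
      rw [hlMax_le_iff]
      intro r hr
      rcases le_or_gt 1 r with h | h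
      · exact (hlarge x r h).trans (by gcongr; exact le_add_self)
      · refine le_trans ?_ ((lintegral_ball_le_hlMax G' x hr).trans (by gcongr; exact le_self_add))
        refine setLIntegral_mono' Metric.isOpen_ball.measurableSet fun y hy => ?_
        rw [hG', indicator_of_mem]
        rw [Metric.mem_ball] at *
        have := dist_triangle y x 0
        linarith
    have hz : volume {x | hlMax G' x = ⊤} = 0 := by
      by_contra hne
      obtain ⟨m, hm⟩ := ENNReal.exists_nat_mul_gt hne
        (ENNReal.mul_ne_top (by finiteness : (4 ^ n : ℝ≥0∞) ≠ ⊤) hI)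
      refine absurd hm (not_lt.2 (le_trans ?_ (mul_volume_hlMax_le hn G' m)))
      gcongr with x hx
      intro h
      rw [h]; exact ENNReal.natCast_lt_top m
    filter_upwards [measure_eq_zero_iff_ae_notMem.1 hz] with x hx hxk
    have : hlMax G' x ≠ ⊤ := hx
    exact (hle x hxk).trans_lt (by finiteness)
  filter_upwards [ae_all_iff.2 hk] with x hx
  obtain ⟨k, hk⟩ := exists_nat_gt ‖x‖
  exact hx k (by simpa using hk)

/-! ### Poincaré and Sobolev–Poincaré inequalities for C¹ functions. -/

theorem rpow_lintegral_le_lintegral_rpow {X : Type*} [MeasurableSpace X] (μ : Measure X)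
    [IsProbabilityMeasure μ] {f : X → ℝ≥0∞} (hf : AEMeasurable f μ) {p : ℝ} (hp : 1 ≤ p) :
    (∫⁻ x, f x ∂μ) ^ p ≤ ∫⁻ x, f x ^ p ∂μ := by
  rcases hp.eq_or_lt with rfl | hp
  · simp
  have hp0 : 0 < p := by linarith
  have := ENNReal.lintegral_mul_le_Lp_mul_Lq μ (Real.HolderConjugate.conjExponent hp) hf
    (aemeasurable_const (b := (1 : ℝ≥0∞)))
  simp only [Pi.mul_apply, mul_one, ENNReal.one_rpow, lintegral_const, measure_univ] at this
  calc _ ≤ ((∫⁻ x, f x ^ p ∂μ) ^ (1 / p)) ^ p := by gcongr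
    _ = _ := by rw [← ENNReal.rpow_mul, one_div_mul_cancel hp0.ne', ENNReal.rpow_one]

theorem lintegral_comp_add_smul {n : ℕ} (a : Eucl n) {t : ℝ} (ht : 0 < t) {Φ : Eucl n → ℝ≥0∞}
    (hΦ : Measurable Φ) :
    ∫⁻ y, Φ (a + t • y) = ENNReal.ofReal t⁻¹ ^ n * ∫⁻ y, Φ y := by
  have h1 : ∫⁻ y, Φ (a + t • y) = ∫⁻ z, Φ (a + z) ∂(Measure.map (t • ·) volume) :=
    (lintegral_map (by fun_prop : Measurable fun z => Φ (a + z)) (by fun_prop)).symm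
  rw [h1, Measure.map_addHaar_smul _ ht.ne', lintegral_smul_measure, lintegral_add_left_eq_self,
    finrank_euclideanSpace, Fintype.card_fin, ← ENNReal.ofReal_pow (by positivity), inv_pow,
    abs_of_pos (by positivity)]
  rfl

theorem lintegral_ball_comp_segment_le {n : ℕ} (x₀ x : Eucl n) {r : ℝ}
    (hx : x ∈ Metric.ball x₀ r) {t : ℝ} (ht : 1 / 2 ≤ t) (ht1 : t ≤ 1) {F : Eucl n → ℝ≥0∞}
    (hF : Measurable F) :
    ∫⁻ y in Metric.ball x₀ r, F ((1 - t) • x + t • y) ≤ 2 ^ n * ∫⁻ z in Metric.ball x₀ r, F z := by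
  have ht0 : 0 < t := by linarith
  have hball := (Metric.isOpen_ball (x := x₀) (ε := r)).measurableSet
  rw [← lintegral_indicator hball]
  calc _ ≤ ∫⁻ y, (Metric.ball x₀ r).indicator F ((1 - t) • x + t • y) := by
        refine lintegral_mono fun y => ?_
        by_cases hy : y ∈ Metric.ball x₀ r
        · have := convex_ball x₀ r hx hy (by linarith : 0 ≤ 1 - t) ht0.le (by ring)
          rw [indicator_of_mem hy, indicator_of_mem this]
        · rw [indicator_of_notMem hy]; exact zero_le
    _ = ENNReal.ofReal t⁻¹ ^ n * ∫⁻ z in Metric.ball x₀ r, F z := by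
        rw [lintegral_comp_add_smul _ ht0 (hF.indicator hball), lintegral_indicator hball]
    _ ≤ _ := by
        gcongr
        rw [show (2 : ℝ≥0∞) = ENNReal.ofReal 2 by simp]
        refine ENNReal.ofReal_le_ofReal ?_
        rw [inv_le_comm₀ ht0 (by norm_num)]
        linarith

theorem lintegral_ball_ball_comp_segment_le {n : ℕ} (x₀ : Eucl n) {r t : ℝ} (ht0 : 0 ≤ t)
    (ht1 : t ≤ 1) {F : Eucl n → ℝ≥0∞} (hF : Measurable F) :
    ∫⁻ x in Metric.ball x₀ r, ∫⁻ y in Metric.ball x₀ r, F ((1 - t) • x + t • y) ≤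
      2 ^ n * volume (Metric.ball x₀ r) * ∫⁻ z in Metric.ball x₀ r, F z := by
  have hball := (Metric.isOpen_ball (x := x₀) (ε := r)).measurableSet
  -- Exchanging x and y replaces t by 1 - t, so one may rescale the variable with the larger
  -- coefficient; the Jacobian is then at most 2^n.
  wlog h : 1 / 2 ≤ t generalizing t
  · have := this (t := 1 - t) (by linarith) (by linarith) (by linarith)
    rw [lintegral_lintegral_swap] at this
    · simpa only [sub_sub_cancel, add_comm] using this
    · fun_prop
  calc _ ≤ ∫⁻ x in Metric.ball x₀ r, 2 ^ n * ∫⁻ z in Metric.ball x₀ r, F z :=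
        setLIntegral_mono' hball fun x hx => lintegral_ball_comp_segment_le x₀ x hx h ht1 hF
    _ = _ := by rw [setLIntegral_const]; ring

theorem enorm_sub_rpow_le {n : ℕ} {u : Eucl n → ℝ} (hu : ContDiff ℝ 1 u) {p : ℝ} (hp : 1 ≤ p)
    (x y : Eucl n) :
    ‖u x - u y‖ₑ ^ p ≤
      ‖x - y‖ₑ ^ p * ∫⁻ t in Ioc (0 : ℝ) 1, ‖fderiv ℝ u ((1 - t) • x + t • y)‖ₑ ^ p := by
  have hcont : Continuous (fderiv ℝ u) := hu.continuous_fderiv one_ne_zero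
  have hderiv : ∀ t : ℝ, HasDerivAt (fun t : ℝ => u ((1 - t) • x + t • y))
      (fderiv ℝ u ((1 - t) • x + t • y) (y - x)) t := by
    intro t
    have h1 : HasDerivAt (fun t : ℝ => (1 - t) • x + t • y) (y - x) t := by
      have h2 : HasDerivAt (fun t : ℝ => (1 - t) • x + t • y) ((-1 : ℝ) • x + (1 : ℝ) • y) t :=
        (((hasDerivAt_id t).const_sub 1).smul_const x).add ((hasDerivAt_id t).smul_const y)
      rwa [neg_smul, one_smul, one_smul, neg_add_eq_sub] at h2
    exact ((hu.differentiable one_ne_zero _).hasFDerivAt).comp_hasDerivAt t h1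
  have hint : u y - u x = ∫ t in (0 : ℝ)..1, fderiv ℝ u ((1 - t) • x + t • y) (y - x) := by
    rw [intervalIntegral.integral_eq_sub_of_hasDerivAt (fun t _ => hderiv t)]
    · simp
    · exact Continuous.intervalIntegrable (by fun_prop) _ _
  have hprob : IsProbabilityMeasure (volume.restrict (Ioc (0 : ℝ) 1)) := ⟨by simp⟩
  have hmeas : Continuous fun t : ℝ => ‖fderiv ℝ u ((1 - t) • x + t • y)‖ₑ := by fun_prop
  have h1 : ‖u x - u y‖ₑ ≤
      ‖x - y‖ₑ * ∫⁻ t in Ioc (0 : ℝ) 1, ‖fderiv ℝ u ((1 - t) • x + t • y)‖ₑ := by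
    rw [← enorm_neg, neg_sub, hint, intervalIntegral.integral_of_le zero_le_one,
      ← lintegral_const_mul' _ _ enorm_ne_top]
    refine (enorm_integral_le_lintegral_enorm _).trans (lintegral_mono fun t => ?_)
    rw [mul_comm, ← enorm_neg (x - y), neg_sub]
    exact ContinuousLinearMap.le_opENorm _ _
  calc _ ≤ (‖x - y‖ₑ * ∫⁻ t in Ioc (0 : ℝ) 1, ‖fderiv ℝ u ((1 - t) • x + t • y)‖ₑ) ^ p := by
        gcongr
    _ ≤ _ := by
        rw [ENNReal.mul_rpow_of_nonneg _ _ (by linarith)]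
        gcongr
        exact rpow_lintegral_le_lintegral_rpow _ hmeas.measurable.aemeasurable hp

/-- The difference is controlled by the derivative along the segment from x to y. Integrating in the
segment parameter last allows a linear change of variables for each fixed parameter. -/
theorem lintegral_ball_ball_enorm_sub_rpow_le {n : ℕ} {u : Eucl n → ℝ} (hu : ContDiff ℝ 1 u)
    {p : ℝ} (hp : 1 ≤ p) (x₀ : Eucl n) (r : ℝ) :
    ∫⁻ x in Metric.ball x₀ r, ∫⁻ y in Metric.ball x₀ r, ‖u x - u y‖ₑ ^ p ≤
      ENNReal.ofReal (2 * r) ^ p * (2 ^ n * volume (Metric.ball x₀ r) *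
        ∫⁻ z in Metric.ball x₀ r, ‖fderiv ℝ u z‖ₑ ^ p) := by
  have hcont : Continuous (fderiv ℝ u) := hu.continuous_fderiv one_ne_zero
  have hp0 : 0 ≤ p := by linarith
  have hball := (Metric.isOpen_ball (x := x₀) (ε := r)).measurableSet
  set F : Eucl n → ℝ≥0∞ := fun z => ‖fderiv ℝ u z‖ₑ ^ p with hF
  have hFc : Continuous F := ENNReal.continuous_rpow_const.comp hcont.enorm
  have hFm : Measurable F := hFc.measurable
  calc _ ≤ ∫⁻ x in Metric.ball x₀ r, ∫⁻ y in Metric.ball x₀ r, ENNReal.ofReal (2 * r) ^ p *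
          ∫⁻ t in Ioc (0 : ℝ) 1, F ((1 - t) • x + t • y) := by
        refine setLIntegral_mono' hball fun x hx => setLIntegral_mono' hball fun y hy => ?_
        refine (enorm_sub_rpow_le hu hp x y).trans ?_
        gcongr
        rw [← ofReal_norm, ← dist_eq_norm]
        refine ENNReal.ofReal_le_ofReal ?_
        have := dist_triangle_right x y x₀
        rw [Metric.mem_ball] at hx hy
        linarith
    _ = ENNReal.ofReal (2 * r) ^ p * ∫⁻ x in Metric.ball x₀ r, ∫⁻ y in Metric.ball x₀ r,
          ∫⁻ t in Ioc (0 : ℝ) 1, F ((1 - t) • x + t • y) := by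
        rw [← lintegral_const_mul' _ _ (by finiteness)]
        refine lintegral_congr fun x => ?_
        rw [← lintegral_const_mul' _ _ (by finiteness)]
    _ = ENNReal.ofReal (2 * r) ^ p * ∫⁻ t in Ioc (0 : ℝ) 1, ∫⁻ x in Metric.ball x₀ r,
          ∫⁻ y in Metric.ball x₀ r, F ((1 - t) • x + t • y) := by
        congr 1
        have h1 : ∀ x : Eucl n, ∫⁻ y in Metric.ball x₀ r, ∫⁻ t in Ioc (0 : ℝ) 1,
            F ((1 - t) • x + t • y) = ∫⁻ t in Ioc (0 : ℝ) 1, ∫⁻ y in Metric.ball x₀ r,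
              F ((1 - t) • x + t • y) := fun x =>
          lintegral_lintegral_swap (Measurable.aemeasurable (by fun_prop))
        simp_rw [h1]
        refine lintegral_lintegral_swap (Measurable.aemeasurable ?_)
        refine Measurable.lintegral_prod_right' (f := fun q : (Eucl n × ℝ) × Eucl n =>
          F ((1 - q.1.2) • q.1.1 + q.1.2 • q.2)) ?_
        fun_prop
    _ ≤ ENNReal.ofReal (2 * r) ^ p * ∫⁻ t in Ioc (0 : ℝ) 1, (2 ^ n * volume (Metric.ball x₀ r) *
          ∫⁻ z in Metric.ball x₀ r, F z) := by
        refine mul_le_mul_right ?_ _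
        exact setLIntegral_mono' measurableSet_Ioc fun t ht =>
          lintegral_ball_ball_comp_segment_le x₀ ht.1.le ht.2 hFm
    _ = _ := by simp

/-- The Poincaré inequality on balls. -/
theorem exists_lintegral_ball_enorm_sub_rpow_le {n : ℕ} {u : Eucl n → ℝ} (hu : ContDiff ℝ 1 u)
    {p : ℝ} (hp : 1 ≤ p) (x₀ : Eucl n) {r : ℝ} (hr : 0 < r) :
    ∃ c : ℝ, ∫⁻ x in Metric.ball x₀ r, ‖u x - c‖ₑ ^ p ≤
      ENNReal.ofReal (2 * r) ^ p * (2 ^ n * ∫⁻ z in Metric.ball x₀ r, ‖fderiv ℝ u z‖ₑ ^ p) := by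
  have hv0 := volume_ball_ne_zero x₀ hr
  have hvt := volume_ball_ne_top x₀ (r := r)
  have hc := hu.continuous
  have hm : Measurable fun y => ∫⁻ x in Metric.ball x₀ r, ‖u x - u y‖ₑ ^ p := by
    refine Measurable.lintegral_prod_right' (f := fun q : Eucl n × Eucl n =>
      ‖u q.2 - u q.1‖ₑ ^ p) ?_
    fun_prop
  -- The constant is a value u(y) at a point y where the inner integral does not exceed its average
  -- over the ball.
  obtain ⟨y, -, hy⟩ := exists_le_setLAverage hv0 hvt hm.aemeasurable
  refine ⟨u y, hy.trans ?_⟩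
  rw [setLAverage_eq, ENNReal.div_le_iff_le_mul (Or.inl hv0) (Or.inl hvt)]
  calc _ ≤ _ := by
        have := lintegral_ball_ball_enorm_sub_rpow_le hu hp x₀ r
        simp_rw [← enorm_neg (u _ - u _), neg_sub] at this
        exact this
    _ = _ := by ring

theorem exists_eLpNorm_ball_sub_le {n : ℕ} {u : Eucl n → ℝ} (hu : ContDiff ℝ 1 u)
    {p : ℝ≥0} (hp : 1 ≤ p) (x₀ : Eucl n) {r : ℝ} (hr : 0 < r) :
    ∃ c : ℝ, eLpNorm (fun x => u x - c) p (volume.restrict (Metric.ball x₀ r)) ≤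
      ENNReal.ofReal (2 * r) * 2 ^ n *
        eLpNorm (fderiv ℝ u) p (volume.restrict (Metric.ball x₀ r)) := by
  have hp1 : (1 : ℝ) ≤ p := by exact_mod_cast hp
  have hp0 : (0 : ℝ) < p := by linarith
  have hpne : (p : ℝ≥0∞) ≠ 0 := by exact_mod_cast (by positivity : (p : ℝ) ≠ 0)
  obtain ⟨c, hc⟩ := exists_lintegral_ball_enorm_sub_rpow_le hu hp1 x₀ hr
  refine ⟨c, ?_⟩
  rw [eLpNorm_eq_lintegral_rpow_enorm_toReal hpne ENNReal.coe_ne_top,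
    eLpNorm_eq_lintegral_rpow_enorm_toReal hpne ENNReal.coe_ne_top, ENNReal.coe_toReal]
  refine (ENNReal.rpow_le_rpow hc (by positivity)).trans ?_
  rw [ENNReal.mul_rpow_of_nonneg _ _ (by positivity), ENNReal.mul_rpow_of_nonneg _ _ (by positivity),
    ← ENNReal.rpow_mul, mul_one_div_cancel hp0.ne', ENNReal.rpow_one, ← mul_assoc]
  gcongr
  have h1 : (1 : ℝ≥0∞) ≤ 2 ^ n := one_le_pow₀ one_le_two
  calc ((2 : ℝ≥0∞) ^ n) ^ (1 / (p : ℝ)) ≤ (2 ^ n) ^ (1 : ℝ) :=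
        ENNReal.rpow_le_rpow_of_exponent_le h1 (by rwa [div_le_one hp0])
    _ = 2 ^ n := ENNReal.rpow_one _

/-- All cutoffs are translated and rescaled copies of one bump, so D depends on neither centre nor
radius. -/
theorem exists_bump_fderiv_le (n : ℕ) : ∃ D : ℝ≥0, ∀ (x₀ : Eucl n) (r : ℝ), 0 < r →
    ∃ χ : Eucl n → ℝ, ContDiff ℝ 1 χ ∧ tsupport χ ⊆ Metric.ball x₀ (2 * r) ∧
      HasCompactSupport χ ∧
      (∀ y ∈ Metric.ball x₀ r, χ y = 1) ∧ (∀ y, ‖χ y‖ₑ ≤ 1) ∧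
      ∀ y, ‖fderiv ℝ χ y‖ₑ ≤ D * ENNReal.ofReal r⁻¹ := by
  let η : ContDiffBump (0 : Eucl n) := ⟨1, 3 / 2, by norm_num, by norm_num⟩
  have hη : ContDiff ℝ 1 η := η.contDiff
  have hdc : Continuous (fderiv ℝ η) := hη.continuous_fderiv one_ne_zero
  have hds : HasCompactSupport (fderiv ℝ η) := η.hasCompactSupport.fderiv (𝕜 := ℝ)
  obtain ⟨D, hD⟩ := hds.exists_bound_of_continuous hdc
  refine ⟨D.toNNReal, fun x₀ r hr => ⟨fun y => η (r⁻¹ • (y - x₀)), ?_, ?_, ?_, ?_, ?_, ?_⟩⟩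
  · fun_prop
  · refine (closure_minimal (t := Metric.closedBall x₀ (3 / 2 * r)) ?_
      Metric.isClosed_closedBall).trans (Metric.closedBall_subset_ball (by linarith))
    intro y hy
    have h1 : r⁻¹ • (y - x₀) ∈ Function.support η := hy
    rw [η.support_eq, mem_ball_zero_iff, norm_smul, norm_inv, Real.norm_of_nonneg hr.le,
      inv_mul_lt_iff₀ hr] at h1
    rw [Metric.mem_closedBall, dist_eq_norm, mul_comm]
    exact h1.le
  · refine HasCompactSupport.of_support_subset_isCompact
      (isCompact_closedBall x₀ (3 / 2 * r)) ?_
    intro y hy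
    have h1 : r⁻¹ • (y - x₀) ∈ Function.support η := hy
    rw [η.support_eq, mem_ball_zero_iff, norm_smul, norm_inv, Real.norm_of_nonneg hr.le,
      inv_mul_lt_iff₀ hr] at h1
    rw [Metric.mem_closedBall, dist_eq_norm, mul_comm]
    exact h1.le
  · intro y hy
    refine η.one_of_mem_closedBall ?_
    rw [mem_closedBall_zero_iff, norm_smul, norm_inv, Real.norm_of_nonneg hr.le,
      inv_mul_le_iff₀ hr, ← dist_eq_norm]
    exact (Metric.mem_ball.1 hy).le.trans (by simp [η])
  · intro y
    rw [← ofReal_norm, Real.norm_of_nonneg η.nonneg, ENNReal.ofReal_le_one]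
    exact η.le_one
  · intro y
    have h1 : HasFDerivAt (fun y : Eucl n => r⁻¹ • (y - x₀))
        (r⁻¹ • ContinuousLinearMap.id ℝ (Eucl n)) y :=
      ((hasFDerivAt_id y).sub_const x₀).const_smul r⁻¹
    have h2 := ((hη.differentiable one_ne_zero (r⁻¹ • (y - x₀))).hasFDerivAt).comp y h1
    have h3 : fderiv ℝ (fun y => η (r⁻¹ • (y - x₀))) y =
        r⁻¹ • fderiv ℝ η (r⁻¹ • (y - x₀)) := by
      rw [show (fun y => η (r⁻¹ • (y - x₀))) = η ∘ fun y => r⁻¹ • (y - x₀) from rfl, h2.fderiv]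
      ext v
      simp
    rw [h3, ← ofReal_norm, norm_smul, norm_inv, Real.norm_of_nonneg hr.le, mul_comm,
      ENNReal.ofReal_mul (norm_nonneg _)]
    gcongr
    exact ENNReal.ofReal_le_ofReal (hD _)

/-- The Sobolev–Poincaré inequality for `C¹` functions. -/
theorem exists_sobolevPoincare_contDiff {n : ℕ} (hn : 0 < n) {p p' : ℝ≥0} (hp : 1 ≤ p)
    (hp' : (p' : ℝ)⁻¹ = (p : ℝ)⁻¹ - (n : ℝ)⁻¹) :
    ∃ C : ℝ≥0, ∀ u : Eucl n → ℝ, ContDiff ℝ 1 u → ∀ (x₀ : Eucl n) (r : ℝ), 0 < r →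
      ∃ c : ℝ, eLpNorm (fun x => u x - c) p' (volume.restrict (Metric.ball x₀ r)) ≤
        C * eLpNorm (fderiv ℝ u) p (volume.restrict (Metric.ball x₀ (2 * r))) := by
  obtain ⟨D, hD⟩ := exists_bump_fderiv_le n
  set S := SNormLESNormFDerivOfEqConst ℝ (volume : Measure (Eucl n)) p with hS
  refine ⟨S * (1 + D * (4 * 2 ^ n)), fun u hu x₀ r hr => ?_⟩
  obtain ⟨χ, hχ, hχs, hχc, hχ1, hχle, hχd⟩ := hD x₀ r hr
  have hr2 : 0 < 2 * r := by linarith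
  obtain ⟨c, hc⟩ := exists_eLpNorm_ball_sub_le hu hp x₀ hr2
  refine ⟨c, ?_⟩
  have hball : ∀ r, MeasurableSet (Metric.ball x₀ r) := fun r => Metric.isOpen_ball.measurableSet
  set B := Metric.ball x₀ (2 * r) with hB
  -- The global Sobolev inequality is applied to the cut-off function. Differentiating the cutoff
  -- costs 1/r, which the factor 4r of the Poincaré inequality on the ball of radius 2r compensates.
  set v : Eucl n → ℝ := fun y => χ y * (u y - c) with hv
  have huc : ContDiff ℝ 1 fun y => u y - c := by fun_prop
  have hvc : ContDiff ℝ 1 v := hχ.mul huc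
  have hvs : HasCompactSupport v := hχc.mul_right
  have hp1 : (1 : ℝ≥0∞) ≤ p := by exact_mod_cast hp
  have h1 : eLpNorm (fun x => u x - c) p' (volume.restrict (Metric.ball x₀ r)) ≤
      eLpNorm v p' volume := by
    refine le_trans (b := eLpNorm v p' (volume.restrict (Metric.ball x₀ r))) (le_of_eq ?_) (eLpNorm_mono_measure v Measure.restrict_le_self)
    refine eLpNorm_congr_ae ?_
    filter_upwards [ae_restrict_mem (hball r)] with y hy
    simp [hv, hχ1 y hy]
  have h2 : eLpNorm v p' volume ≤ S * eLpNorm (fderiv ℝ v) p volume :=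
    eLpNorm_le_eLpNorm_fderiv_of_eq _ hvc hvs hp (by simpa using hn) (by simpa using hp')
  have h3 : eLpNorm (fderiv ℝ v) p volume = eLpNorm (fderiv ℝ v) p (volume.restrict B) := by
    have h5 : tsupport v ⊆ tsupport χ := closure_mono (Function.support_mul_subset_left _ _)
    have h6 : Function.support (fun y => ‖fderiv ℝ v y‖) ⊆ B := fun y hy =>
      hχs (h5 (support_fderiv_subset ℝ fun h => hy (by simp only [h, norm_zero])))
    rw [← eLpNorm_norm (fderiv ℝ v), ← eLpNorm_norm (fderiv ℝ v)]
    exact (eLpNorm_restrict_eq_of_support_subset h6).symm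
  have hfd : ∀ y, fderiv ℝ v y = χ y • fderiv ℝ u y + (u y - c) • fderiv ℝ χ y := by
    intro y
    rw [hv, fderiv_fun_mul (hχ.differentiable one_ne_zero y) (huc.differentiable one_ne_zero y),
      fderiv_sub_const]
  have hcu : Continuous (fderiv ℝ u) := hu.continuous_fderiv one_ne_zero
  have h4 : eLpNorm (fderiv ℝ v) p (volume.restrict B) ≤
      eLpNorm (fderiv ℝ u) p (volume.restrict B) +
        (D * ENNReal.ofReal r⁻¹) * eLpNorm (fun y => u y - c) p (volume.restrict B) := by
    have e : ∀ y, ‖fderiv ℝ v y‖ ≤ ‖fderiv ℝ u y‖ + (D * r⁻¹) * ‖u y - c‖ := by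
      intro y
      rw [hfd]
      refine (norm_add_le _ _).trans (add_le_add ?_ ?_)
      · rw [norm_smul]
        refine mul_le_of_le_one_left (norm_nonneg _) ?_
        have := hχle y
        rwa [← ofReal_norm, ENNReal.ofReal_le_one] at this
      · rw [norm_smul, mul_comm]
        refine mul_le_mul_of_nonneg_right ?_ (norm_nonneg _)
        have := hχd y
        rw [← ofReal_norm, ← ENNReal.ofReal_coe_nnreal, ← ENNReal.ofReal_mul D.coe_nonneg] at this
        exact (ENNReal.ofReal_le_ofReal_iff (by positivity)).1 this
    refine (eLpNorm_mono_real e).trans ?_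
    refine (eLpNorm_add_le (f := fun y => ‖fderiv ℝ u y‖)
      (g := fun y => (D * r⁻¹) * ‖u y - c‖) ?_ ?_ hp1).trans (add_le_add ?_ ?_)
    · exact hcu.norm.aestronglyMeasurable
    · exact (continuous_const.mul huc.continuous.norm).aestronglyMeasurable
    · rw [eLpNorm_norm]
    · refine (eLpNorm_const_smul (D * r⁻¹ : ℝ) (fun y => ‖u y - c‖) _ _).le.trans ?_
      rw [eLpNorm_norm, ← ofReal_norm, Real.norm_of_nonneg (by positivity),
        ENNReal.ofReal_mul D.coe_nonneg, ENNReal.ofReal_coe_nnreal]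
  refine h1.trans (h2.trans ?_)
  rw [h3]
  push_cast
  rw [mul_assoc]
  gcongr
  refine h4.trans ?_
  rw [add_mul, one_mul]
  refine add_le_add le_rfl ?_
  refine (mul_le_mul_right hc _).trans (le_of_eq ?_)
  have : ENNReal.ofReal r⁻¹ * ENNReal.ofReal (2 * (2 * r)) = 4 := by
    rw [← ENNReal.ofReal_mul (by positivity), show r⁻¹ * (2 * (2 * r)) = 4 by field_simp; norm_num]
    simp
  calc _ = D * ((ENNReal.ofReal r⁻¹ * ENNReal.ofReal (2 * (2 * r))) * 2 ^ n) *
      eLpNorm (fderiv ℝ u) p (volume.restrict B) := by ring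
    _ = _ := by rw [this]

/-! ### Mollification and weak gradients. -/

section Mollification

variable {n : ℕ} (φ : ContDiffBump (0 : Eucl n))

/-- The mollification of `f` by the bump function `φ`. -/
noncomputable def mollify (f : Eucl n → ℝ) : Eucl n → ℝ :=
  convolution (φ.normed volume) f (ContinuousLinearMap.lsmul ℝ ℝ) volume

theorem contDiff_mollify {f : Eucl n → ℝ} (hf : LocallyIntegrable f) :
    ContDiff ℝ 1 (mollify φ f) :=
  HasCompactSupport.contDiff_convolution_left _ φ.hasCompactSupport_normed φ.contDiff_normed hf

/-- Differentiation falls on the kernel, and y ↦ φ(x - y) is an admissible test function; the sign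
from the reflection cancels the one in the weak gradient identity. -/
theorem fderiv_mollify_apply {f : Eucl n → ℝ} {g : Eucl n → Eucl n} (h : HasWeakGradient f g)
    (x v : Eucl n) :
    fderiv ℝ (mollify φ f) x v = ∫ y, inner ℝ (g y) v * φ.normed volume (x - y) := by
  obtain ⟨hf, -, hfg⟩ := h
  have hφ1 : ContDiff ℝ 1 (φ.normed volume) := φ.contDiff_normed
  have hφi : ContDiff ℝ ∞ (φ.normed volume) := φ.contDiff_normed
  have hcs := φ.hasCompactSupport_normed (μ := (volume : Measure (Eucl n)))
  have h1 := HasCompactSupport.hasFDerivAt_convolution_left (ContinuousLinearMap.lsmul ℝ ℝ)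
    hcs hφ1 hf x
  set ψ : Eucl n → ℝ := fun y => φ.normed volume (x - y) with hψ
  have hψc : ContDiff ℝ ∞ ψ := hφi.comp (contDiff_const.sub contDiff_id)
  have hψs : HasCompactSupport ψ := hcs.comp_homeomorph (Homeomorph.subLeft x)
  have hψd : ∀ y, fderiv ℝ ψ y v = - fderiv ℝ (φ.normed volume) (x - y) v := by
    intro y
    have h3 : HasFDerivAt (fun y : Eucl n => x - y) (-ContinuousLinearMap.id ℝ (Eucl n)) y :=
      (hasFDerivAt_id y).const_sub x
    have h4 := ((hφ1.differentiable one_ne_zero (x - y)).hasFDerivAt).comp y h3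
    rw [show ψ = φ.normed volume ∘ fun y => x - y from rfl, h4.fderiv]
    simp
  have h2 := hfg ψ hψc hψs v
  have hex : ConvolutionExistsAt (fderiv ℝ (φ.normed volume)) f x
      ((ContinuousLinearMap.lsmul ℝ ℝ).precompL (Eucl n)) volume :=
    (hcs.fderiv (𝕜 := ℝ)).convolutionExists_left _ (hφ1.continuous_fderiv one_ne_zero) hf x
  have h5 : fderiv ℝ (mollify φ f) x v = ∫ y, fderiv ℝ (φ.normed volume) (x - y) v * f y := by
    rw [mollify, h1.fderiv, convolution_eq_swap]
    rw [ContinuousLinearMap.integral_apply]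
    · rfl
    · exact hex.integrable_swap
  rw [h5]
  calc _ = - ∫ y, f y * fderiv ℝ ψ y v := by
        rw [← integral_neg]
        refine integral_congr_ae (Eventually.of_forall fun y => ?_)
        simp only [hψd]; ring
    _ = _ := by rw [h2, neg_neg]

theorem enorm_fderiv_mollify_le {f : Eucl n → ℝ} {g : Eucl n → Eucl n} (h : HasWeakGradient f g)
    (x : Eucl n) :
    ‖fderiv ℝ (mollify φ f) x‖ₑ ≤
      ∫⁻ y, ENNReal.ofReal (φ.normed volume (x - y)) * ‖g y‖ₑ := by
  have hcs := φ.hasCompactSupport_normed (μ := (volume : Measure (Eucl n)))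
  have hψs : HasCompactSupport fun y => φ.normed volume (x - y) :=
    hcs.comp_homeomorph (Homeomorph.subLeft x)
  have hψc : Continuous fun y => φ.normed volume (x - y) :=
    φ.continuous_normed.comp (continuous_const.sub continuous_id)
  have hnn : ∀ y, 0 ≤ φ.normed volume (x - y) := fun y => φ.nonneg_normed _
  have hint : Integrable fun y => φ.normed volume (x - y) * ‖g y‖ := by
    refine (h.2.1.integrable_smul_left_of_hasCompactSupport hψc hψs).norm.congr
      (Eventually.of_forall fun y => ?_)
    simp only [norm_smul, Real.norm_of_nonneg (hnn y)]
  have hle : ‖fderiv ℝ (mollify φ f) x‖ ≤ ∫ y, φ.normed volume (x - y) * ‖g y‖ := by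
    refine ContinuousLinearMap.opNorm_le_bound _
      (integral_nonneg fun y => mul_nonneg (hnn y) (norm_nonneg _)) fun v => ?_
    rw [fderiv_mollify_apply φ h, ← integral_mul_const]
    refine norm_integral_le_of_norm_le (hint.mul_const _) (Eventually.of_forall fun y => ?_)
    rw [norm_mul, Real.norm_of_nonneg (hnn y), mul_comm, mul_assoc]
    exact mul_le_mul_of_nonneg_left (norm_inner_le_norm _ _) (hnn y)
  rw [← ofReal_norm]
  refine (ENNReal.ofReal_le_ofReal hle).trans (le_of_eq ?_)
  rw [ofReal_integral_eq_lintegral_ofReal hint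
    (Eventually.of_forall fun y => mul_nonneg (hnn y) (norm_nonneg _))]
  refine lintegral_congr fun y => ?_
  rw [ENNReal.ofReal_mul (hnn y), ofReal_norm]

theorem lintegral_ofReal_normed : ∫⁻ y, ENNReal.ofReal (φ.normed volume y) = 1 := by
  rw [← ofReal_integral_eq_lintegral_ofReal φ.integrable_normed
    (Eventually.of_forall φ.nonneg_normed), φ.integral_normed, ENNReal.ofReal_one]

/-- Jensen's inequality for the probability measure φ(x - y) dy, then Tonelli. The kernel's support
accounts for the enlargement of the ball. -/
theorem lintegral_ball_fderiv_mollify_le {f : Eucl n → ℝ} {g : Eucl n → Eucl n}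
    (h : HasWeakGradient f g) {p : ℝ} (hp : 1 ≤ p) (x₀ : Eucl n) (R : ℝ) :
    ∫⁻ x in Metric.ball x₀ R, ‖fderiv ℝ (mollify φ f) x‖ₑ ^ p ≤
      ∫⁻ y in Metric.ball x₀ (R + φ.rOut), ‖g y‖ₑ ^ p := by
  have hp0 : 0 ≤ p := by linarith
  have hgm : AEMeasurable (fun y => ‖g y‖ₑ) := h.2.1.aestronglyMeasurable.enorm
  set G : Eucl n → ℝ≥0∞ := AEMeasurable.mk _ hgm with hG
  have hGm : Measurable G := hgm.measurable_mk
  have hGe : (fun y => ‖g y‖ₑ) =ᵐ[volume] G := hgm.ae_eq_mk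
  have hcont : Continuous (φ.normed (volume : Measure (Eucl n))) := φ.continuous_normed
  set k : Eucl n → ℝ≥0∞ := fun y => ENNReal.ofReal (φ.normed volume y) with hk
  have hkm : Measurable k := ENNReal.measurable_ofReal.comp hcont.measurable
  have hJ : ∀ x, ‖fderiv ℝ (mollify φ f) x‖ₑ ^ p ≤ ∫⁻ y, k (x - y) * G y ^ p := by
    intro x
    set μ := (volume : Measure (Eucl n)).withDensity fun y => k (x - y) with hμ
    have hkx : Measurable fun y => k (x - y) := hkm.comp (by fun_prop)
    have hprob : IsProbabilityMeasure μ := ⟨by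
      rw [hμ, withDensity_apply _ MeasurableSet.univ, setLIntegral_univ,
        lintegral_sub_left_eq_self k x]
      exact lintegral_ofReal_normed φ⟩
    have e : ∀ u : Eucl n → ℝ≥0∞, Measurable u → ∫⁻ y, u y ∂μ = ∫⁻ y, k (x - y) * u y :=
      fun u hu => lintegral_withDensity_eq_lintegral_mul _ hkx hu
    calc _ ≤ (∫⁻ y, k (x - y) * ‖g y‖ₑ) ^ p := by
          gcongr
          exact enorm_fderiv_mollify_le φ h x
      _ = (∫⁻ y, G y ∂μ) ^ p := by
          rw [e G hGm]
          congr 1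
          refine lintegral_congr_ae ?_
          filter_upwards [hGe] with y hy
          rw [← hy]
      _ ≤ ∫⁻ y, G y ^ p ∂μ := rpow_lintegral_le_lintegral_rpow μ hGm.aemeasurable hp
      _ = _ := e _ (hGm.pow_const p)
  have hball : ∀ R, MeasurableSet (Metric.ball x₀ R) := fun R => Metric.isOpen_ball.measurableSet
  calc _ ≤ ∫⁻ x in Metric.ball x₀ R, ∫⁻ y, k (x - y) * G y ^ p := lintegral_mono hJ
    _ = ∫⁻ y, ∫⁻ x in Metric.ball x₀ R, k (x - y) * G y ^ p := by
        refine lintegral_lintegral_swap (Measurable.aemeasurable ?_)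
        exact (hkm.comp (by fun_prop : Measurable fun z : Eucl n × Eucl n => z.1 - z.2)).mul
          ((hGm.comp measurable_snd).pow_const p)
    _ ≤ ∫⁻ y, (Metric.ball x₀ (R + φ.rOut)).indicator (fun y => G y ^ p) y := by
        refine lintegral_mono fun y => ?_
        by_cases hy : y ∈ Metric.ball x₀ (R + φ.rOut)
        · rw [indicator_of_mem hy]
          calc _ ≤ ∫⁻ x, k (x - y) * G y ^ p := setLIntegral_le_lintegral _ _
            _ = (∫⁻ x, k (x - y)) * G y ^ p :=
              lintegral_mul_const _ (hkm.comp (by fun_prop))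
            _ = _ := by
              rw [lintegral_sub_right_eq_self k y, hk, lintegral_ofReal_normed φ, one_mul]
        · rw [setLIntegral_congr_fun (g := fun _ => 0) (hball R) fun x hx => ?_]
          · simp
          · have : k (x - y) = 0 := by
              have h0 : φ.normed volume (x - y) = 0 := by
                rw [← Function.notMem_support, φ.support_normed_eq, mem_ball_zero_iff, not_lt]
                rw [Metric.mem_ball] at hx hy
                have := dist_triangle_left y x₀ x
                rw [← dist_eq_norm]
                linarith
              simp [hk, h0]
            simp [this]
    _ = ∫⁻ y in Metric.ball x₀ (R + φ.rOut), G y ^ p := lintegral_indicator (hball _) _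
    _ = _ := by
        refine lintegral_congr_ae (ae_restrict_of_ae ?_)
        filter_upwards [hGe] with y hy
        rw [← hy]

end Mollification

/-! ### Sobolev–Poincaré inequality for weak gradients. -/

/-- Passing to the double integral eliminates the constant c, which would otherwise vary with the
mollification parameter and have to be controlled in the limit. -/
theorem lintegral_lintegral_enorm_sub_rpow_le {X : Type*} [MeasurableSpace X] (μ : Measure X)
    {u : X → ℝ} (hu : AEMeasurable u μ) {s : ℝ} (hs : 1 ≤ s) (c : ℝ) :
    ∫⁻ x, ∫⁻ y, ‖u x - u y‖ₑ ^ s ∂μ ∂μ ≤ 2 ^ s * μ univ * ∫⁻ x, ‖u x - c‖ₑ ^ s ∂μ := by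
  have hm : AEMeasurable (fun x => ‖u x - c‖ₑ ^ s) μ := by fun_prop
  calc _ ≤ ∫⁻ x, ∫⁻ y, 2 ^ (s - 1) * (‖u x - c‖ₑ ^ s + ‖u y - c‖ₑ ^ s) ∂μ ∂μ := by
        refine lintegral_mono fun x => lintegral_mono fun y => ?_
        refine le_trans ?_ (ENNReal.rpow_add_le_mul_rpow_add_rpow _ _ hs)
        gcongr
        rw [show u x - u y = (u x - c) - (u y - c) by ring]
        exact enorm_sub_le
    _ = 2 ^ (s - 1) * (2 * (μ univ * ∫⁻ x, ‖u x - c‖ₑ ^ s ∂μ)) := by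
        simp_rw [lintegral_const_mul' _ _ (by finiteness : (2 : ℝ≥0∞) ^ (s - 1) ≠ ⊤)]
        congr 1
        simp_rw [lintegral_add_left measurable_const, lintegral_const]
        rw [lintegral_add_right _ measurable_const, lintegral_mul_const'' _ hm, lintegral_const]
        ring
    _ = _ := by
        have : (2 : ℝ≥0∞) ^ s = 2 ^ (s - 1) * 2 := by
          conv_lhs => rw [show s = (s - 1) + 1 by ring]
          rw [ENNReal.rpow_add _ _ (by norm_num) (by norm_num), ENNReal.rpow_one]
        rw [this]; ring

/-- The Sobolev–Poincaré inequality for weakly differentiable functions. -/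
theorem exists_sobolevPoincare {n : ℕ} (hn : 0 < n) {p p' : ℝ≥0} (hp : 1 ≤ p) (hp1' : 1 ≤ p')
    (hp' : (p' : ℝ)⁻¹ = (p : ℝ)⁻¹ - (n : ℝ)⁻¹) :
    ∃ C : ℝ≥0, ∀ (f : Eucl n → ℝ) (g : Eucl n → Eucl n), HasWeakGradient f g →
      ∀ (x₀ : Eucl n) (r : ℝ), 0 < r →
      ∃ c : ℝ, eLpNorm (fun x => f x - c) p' (volume.restrict (Metric.ball x₀ r)) ≤
        C * eLpNorm g p (volume.restrict (Metric.ball x₀ (3 * r))) := by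
  obtain ⟨C, hC⟩ := exists_sobolevPoincare_contDiff hn hp hp'
  refine ⟨2 * C, fun f g h x₀ r hr => ?_⟩
  have hpR : (1 : ℝ) ≤ p := by exact_mod_cast hp
  have hsR : (1 : ℝ) ≤ p' := by exact_mod_cast hp1'
  have hs0 : (0 : ℝ) < p' := by linarith
  have hpne : (p : ℝ≥0∞) ≠ 0 := by exact_mod_cast (by positivity : (p : ℝ) ≠ 0)
  have hsne : (p' : ℝ≥0∞) ≠ 0 := by exact_mod_cast hs0.ne'
  set Λ := C * eLpNorm g p (volume.restrict (Metric.ball x₀ (3 * r))) with hΛ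
  set μ := volume.restrict (Metric.ball x₀ r) with hμ
  have hμu : μ univ = volume (Metric.ball x₀ r) := by simp [hμ]
  have hfm : AEStronglyMeasurable f μ := h.1.aestronglyMeasurable.restrict
  -- Outer radii at most r enlarge the ball of radius 2r to at most 3r. The fixed ratio 2 of the
  -- radii is what almost everywhere convergence of the mollifications requires.
  let φ : ℕ → ContDiffBump (0 : Eucl n) := fun k =>
    ⟨r / (2 * (k + 1)), r / (k + 1), by positivity, by
      refine div_lt_div_of_pos_left hr (by positivity) ?_
      have : (0 : ℝ) < k + 1 := by positivity
      linarith⟩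
  have hφr : ∀ k, (φ k).rOut ≤ r := fun k => by
    refine div_le_self hr.le ?_
    have : (0 : ℝ) ≤ k := by positivity
    linarith
  set u : ℕ → Eucl n → ℝ := fun k => mollify (φ k) f with hu
  have huc : ∀ k, ContDiff ℝ 1 (u k) := fun k => contDiff_mollify (φ k) h.1
  have hlim : ∀ᵐ x, Tendsto (fun k => u k x) atTop (𝓝 (f x)) := by
    refine ContDiffBump.ae_convolution_tendsto_right_of_locallyIntegrable (K := 2) ?_ ?_ h.1
    · have := (tendsto_const_div_atTop_nhds_zero_nat r).comp (tendsto_add_atTop_nat 1)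
      refine this.congr fun k => ?_
      simp [φ]
    · refine Eventually.of_forall fun k => le_of_eq ?_
      simp only [φ]
      field_simp
  have hbound : ∀ k, ∫⁻ x, ∫⁻ y, ‖u k x - u k y‖ₑ ^ (p' : ℝ) ∂μ ∂μ ≤
      2 ^ (p' : ℝ) * μ univ * Λ ^ (p' : ℝ) := by
    intro k
    obtain ⟨c, hc⟩ := hC (u k) (huc k) x₀ r hr
    refine (lintegral_lintegral_enorm_sub_rpow_le μ (huc k).continuous.aemeasurable hsR c).trans ?_
    gcongr
    have h1 : eLpNorm (fderiv ℝ (u k)) p (volume.restrict (Metric.ball x₀ (2 * r))) ≤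
        eLpNorm g p (volume.restrict (Metric.ball x₀ (3 * r))) := by
      rw [eLpNorm_eq_lintegral_rpow_enorm_toReal hpne ENNReal.coe_ne_top,
        eLpNorm_eq_lintegral_rpow_enorm_toReal hpne ENNReal.coe_ne_top, ENNReal.coe_toReal]
      refine ENNReal.rpow_le_rpow ?_ (by positivity)
      refine (lintegral_ball_fderiv_mollify_le (φ k) h hpR x₀ (2 * r)).trans ?_
      refine lintegral_mono_set (Metric.ball_subset_ball ?_)
      linarith [hφr k]
    have h2 : eLpNorm (fun x => u k x - c) p' μ ≤ Λ := hc.trans (by rw [hΛ]; gcongr)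
    rw [eLpNorm_eq_lintegral_rpow_enorm_toReal hsne ENNReal.coe_ne_top, ENNReal.coe_toReal] at h2
    rwa [one_div, ENNReal.rpow_inv_le_iff hs0] at h2
  -- Fatou's lemma on the product space carries the uniform bound over to f; a constant is then
  -- recovered as f(y) for a well-chosen y.
  have hfatou : ∫⁻ z, ‖f z.1 - f z.2‖ₑ ^ (p' : ℝ) ∂(μ.prod μ) ≤
      2 ^ (p' : ℝ) * μ univ * Λ ^ (p' : ℝ) := by
    have hae : ∀ᵐ z ∂(μ.prod μ), ‖f z.1 - f z.2‖ₑ ^ (p' : ℝ) =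
        liminf (fun k => ‖u k z.1 - u k z.2‖ₑ ^ (p' : ℝ)) atTop := by
      have hl := ae_restrict_of_ae (s := Metric.ball x₀ r) hlim
      filter_upwards [Measure.quasiMeasurePreserving_fst.ae hl,
        Measure.quasiMeasurePreserving_snd.ae hl] with z h1 h2
      exact (((ENNReal.continuous_rpow_const.comp continuous_enorm).tendsto _).comp
        (h1.sub h2)).liminf_eq.symm
    rw [lintegral_congr_ae hae]
    have huk : ∀ k, Measurable fun z : Eucl n × Eucl n => ‖u k z.1 - u k z.2‖ₑ ^ (p' : ℝ) := by
      intro k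
      have := (huc k).continuous.measurable
      fun_prop
    refine (lintegral_liminf_le huk).trans ?_
    refine liminf_le_of_le (by isBoundedDefault) fun b hb => ?_
    obtain ⟨k, hk⟩ := hb.exists
    refine hk.trans ?_
    rw [lintegral_prod _ (huk k).aemeasurable]
    exact hbound k
  have hfm2 : AEMeasurable (fun z : Eucl n × Eucl n => ‖f z.1 - f z.2‖ₑ ^ (p' : ℝ))
      (μ.prod μ) := ((hfm.comp_fst.sub hfm.comp_snd).enorm).pow_const _
  rw [lintegral_prod_symm _ hfm2] at hfatou
  have hv0 := volume_ball_ne_zero x₀ hr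
  have hvt := volume_ball_ne_top x₀ (r := r)
  obtain ⟨y, -, hy⟩ := exists_le_setLAverage hv0 hvt
    (f := fun y => ∫⁻ x, ‖f x - f y‖ₑ ^ (p' : ℝ) ∂μ) hfm2.lintegral_prod_left'
  refine ⟨f y, ?_⟩
  have hy2 : ∫⁻ x, ‖f x - f y‖ₑ ^ (p' : ℝ) ∂μ ≤ (2 * Λ) ^ (p' : ℝ) := by
    refine hy.trans ?_
    rw [setLAverage_eq, ENNReal.div_le_iff_le_mul (Or.inl hv0) (Or.inl hvt)]
    refine hfatou.trans (le_of_eq ?_)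
    rw [hμu, ENNReal.mul_rpow_of_nonneg 2 Λ hs0.le]
    ring
  rw [eLpNorm_eq_lintegral_rpow_enorm_toReal hsne ENNReal.coe_ne_top, ENNReal.coe_toReal, one_div,
    ENNReal.rpow_inv_le_iff hs0]
  refine hy2.trans (le_of_eq ?_)
  rw [hΛ]
  push_cast
  ring_nf

/-! ### The rough kernel in polar coordinates. -/

section Polar

variable {n : ℕ}

theorem homogExt_coe (Ω : UnitSph n → ℝ) (z : ({0}ᶜ : Set (Eucl n))) :
    homogExt Ω z = Ω (homeomorphUnitSphereProd (Eucl n) z).1 := by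
  rw [homogExt, dif_neg (show (z : Eucl n) ≠ 0 from z.2)]
  congr 1
  ext1
  simp

theorem restrict_compl_zero (hn : n ≠ 0) :
    (volume : Measure (Eucl n)).restrict {0}ᶜ = volume := by
  have : Nonempty (Fin n) := ⟨⟨0, Nat.pos_of_ne_zero hn⟩⟩
  exact restrict_compl_singleton 0

theorem aestronglyMeasurable_homogExt (hn : n ≠ 0) {Ω : UnitSph n → ℝ}
    (hΩ : AEStronglyMeasurable Ω (surfaceMeasure n)) :
    AEStronglyMeasurable (homogExt Ω) volume := by
  have h1 := (hΩ.comp_fst (ν := Measure.volumeIoiPow (Module.finrank ℝ (Eucl n) - 1))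
    ).comp_measurePreserving
      (volume : Measure (Eucl n)).measurePreserving_homeomorphUnitSphereProd
  have h2 : AEStronglyMeasurable (homogExt Ω ∘ ((↑) : ({0}ᶜ : Set (Eucl n)) → Eucl n))
      ((volume : Measure (Eucl n)).comap (↑)) := by
    refine h1.congr (Eventually.of_forall fun z => ?_)
    exact (homogExt_coe Ω z).symm
  rw [← (MeasurableEmbedding.subtype_coe
    (measurableSet_singleton (0 : Eucl n)).compl).aestronglyMeasurable_map_iff,
    map_comap_subtype_coe (measurableSet_singleton _).compl, restrict_compl_zero hn] at h2
  exact h2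

/-- In polar coordinates the integral factors; the radial factor is b^n / n, and the 1/n is
discarded. -/
theorem lintegral_ball_homogExt (hn : n ≠ 0) {Ω : UnitSph n → ℝ}
    (hΩ : AEStronglyMeasurable Ω (surfaceMeasure n)) (ρ : ℝ) {b : ℝ} (hb : 0 < b) :
    ∫⁻ y in Metric.ball (0 : Eucl n) b, ‖homogExt Ω y‖ₑ ^ ρ ≤
      ENNReal.ofReal b ^ n * ∫⁻ θ, ‖Ω θ‖ₑ ^ ρ ∂surfaceMeasure n := by
  set e := homeomorphUnitSphereProd (Eucl n) with he
  have hmp := (volume : Measure (Eucl n)).measurePreserving_homeomorphUnitSphereProd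
  obtain ⟨bb, hbb⟩ : ∃ bb : Ioi (0 : ℝ), (bb : ℝ) = b := ⟨⟨b, mem_Ioi.2 hb⟩, rfl⟩
  have hσ : surfaceMeasure n = (volume : Measure (Eucl n)).toSphere := rfl
  rw [hσ] at hΩ ⊢
  rw [← lintegral_indicator Metric.isOpen_ball.measurableSet]
  conv_lhs =>
    rw [← restrict_compl_zero hn, ← lintegral_subtype_comap (measurableSet_singleton _).compl]
  have h1 : ∀ z : ({0}ᶜ : Set (Eucl n)),
      (Metric.ball (0 : Eucl n) b).indicator (fun y => ‖homogExt Ω y‖ₑ ^ ρ) z =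
        (fun q : UnitSph n × Ioi (0 : ℝ) =>
          ‖Ω q.1‖ₑ ^ ρ * (Iio bb).indicator 1 q.2) (e z) := by
    intro z
    have h2 : (e z).2 ∈ Iio bb ↔ (z : Eucl n) ∈ Metric.ball 0 b := by
      rw [mem_Iio, mem_ball_zero_iff, ← Subtype.coe_lt_coe, hbb]
      simp [he]
    by_cases hz : (z : Eucl n) ∈ Metric.ball 0 b
    · simp only [indicator_of_mem hz, indicator_of_mem (h2.2 hz), homogExt_coe, Pi.one_apply,
        mul_one]
      rfl
    · simp only [indicator_of_notMem hz, indicator_of_notMem (mt h2.1 hz), mul_zero]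
  simp_rw [h1]
  rw [hmp.lintegral_comp_emb e.measurableEmbedding (fun q : UnitSph n × Ioi (0 : ℝ) =>
    ‖Ω q.1‖ₑ ^ ρ * (Iio bb).indicator 1 q.2),
    lintegral_prod_mul (f := fun θ => ‖Ω θ‖ₑ ^ ρ) (hΩ.enorm.pow_const ρ)
      ((measurable_one.indicator measurableSet_Iio).aemeasurable),
    lintegral_indicator_one measurableSet_Iio, Measure.volumeIoiPow_apply_Iio, hbb,
    mul_comm (ENNReal.ofReal b ^ n)]
  refine mul_le_mul' le_rfl ?_
  rw [← ENNReal.ofReal_pow hb.le]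
  refine ENNReal.ofReal_le_ofReal ?_
  have hn1 : 1 ≤ n := Nat.one_le_iff_ne_zero.2 hn
  rw [finrank_euclideanSpace, Fintype.card_fin, Nat.sub_add_cancel hn1]
  refine div_le_self (by positivity) ?_
  simp

theorem measurableSet_annulus (a b : ℝ) : MeasurableSet (annulus n a b) :=
  (isOpen_Ioo.preimage continuous_norm).measurableSet (s := (fun y : Eucl n => ‖y‖) ⁻¹' Ioo a b)

theorem annulus_subset_ball (a b : ℝ) : annulus n a b ⊆ Metric.ball 0 b := fun y hy => by
  rw [mem_ball_zero_iff]; exact hy.2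

/-- The cancellation behind the whole estimate: the kernel is an angular function times a radial
one, and the angular integral vanishes. -/
theorem integral_annulus_homogExt_eq_zero (hn : n ≠ 0) {Ω : UnitSph n → ℝ}
    (hΩ : ∫ θ, Ω θ ∂surfaceMeasure n = 0) (a b : ℝ) :
    ∫ y in annulus n a b, homogExt Ω y / ‖y‖ ^ n = 0 := by
  set e := homeomorphUnitSphereProd (Eucl n) with he
  have hmp := (volume : Measure (Eucl n)).measurePreserving_homeomorphUnitSphereProd
  rw [← integral_indicator (measurableSet_annulus a b),
    ← restrict_compl_zero hn, ← integral_subtype_comap (measurableSet_singleton _).compl]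
  set h : Ioi (0 : ℝ) → ℝ := fun r => (Ioo a b).indicator (fun r => (r ^ n)⁻¹) (r : ℝ) with hh
  have h1 : ∀ z : ({0}ᶜ : Set (Eucl n)),
      (annulus n a b).indicator (fun y => homogExt Ω y / ‖y‖ ^ n) z =
        (fun q : UnitSph n × Ioi (0 : ℝ) => Ω q.1 * h q.2) (e z) := by
    intro z
    have h3 : ((e z).2 : ℝ) = ‖(z : Eucl n)‖ := by simp [he]
    have h2 : ((e z).2 : ℝ) ∈ Ioo a b ↔ (z : Eucl n) ∈ annulus n a b := by
      rw [h3]; rfl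
    by_cases hz : (z : Eucl n) ∈ annulus n a b
    · simp only [indicator_of_mem hz, hh, indicator_of_mem (h2.2 hz), homogExt_coe, div_eq_mul_inv]
      rw [h3]
    · simp only [hh, indicator_of_notMem hz, indicator_of_notMem (mt h2.1 hz), mul_zero]
  simp_rw [h1]
  rw [hmp.integral_comp e.measurableEmbedding (fun q : UnitSph n × Ioi (0 : ℝ) => Ω q.1 * h q.2)]
  have := integral_prod_mul (μ := (volume : Measure (Eucl n)).toSphere)
    (ν := Measure.volumeIoiPow (Module.finrank ℝ (Eucl n) - 1)) Ω h
  rw [this]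
  rw [surfaceMeasure] at hΩ
  rw [hΩ, zero_mul]

/-- Hölder's inequality for the rough kernel on an annulus. -/
theorem lintegral_annulus_homogExt_mul_le (hn : n ≠ 0) {Ω : UnitSph n → ℝ} {ρ ρ' : ℝ}
    (hρ : ρ.HolderConjugate ρ') (hΩ : AEStronglyMeasurable Ω (surfaceMeasure n))
    {a b : ℝ} (ha : 0 < a) (hb : 0 < b) {h : Eucl n → ℝ}
    (hh : AEStronglyMeasurable h (volume.restrict (Metric.ball 0 b))) :
    ∫⁻ y in annulus n a b, ‖homogExt Ω y / ‖y‖ ^ n * h y‖ₑ ≤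
      ENNReal.ofReal a⁻¹ ^ n * (ENNReal.ofReal b ^ (n / ρ) *
        eLpNorm Ω (ENNReal.ofReal ρ) (surfaceMeasure n)) *
        eLpNorm h (ENNReal.ofReal ρ') (volume.restrict (Metric.ball 0 b)) := by
  have hm := aestronglyMeasurable_homogExt hn hΩ
  have e1 : eLpNorm Ω (ENNReal.ofReal ρ) (surfaceMeasure n) =
      (∫⁻ θ, ‖Ω θ‖ₑ ^ ρ ∂surfaceMeasure n) ^ (1 / ρ) := by
    rw [eLpNorm_eq_lintegral_rpow_enorm_toReal (by simpa using hρ.pos) ENNReal.ofReal_ne_top,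
      ENNReal.toReal_ofReal hρ.nonneg]
  have e2 : eLpNorm h (ENNReal.ofReal ρ') (volume.restrict (Metric.ball 0 b)) =
      (∫⁻ y in Metric.ball 0 b, ‖h y‖ₑ ^ ρ') ^ (1 / ρ') := by
    rw [eLpNorm_eq_lintegral_rpow_enorm_toReal (by simpa using hρ.symm.pos) ENNReal.ofReal_ne_top,
      ENNReal.toReal_ofReal hρ.symm.nonneg]
  calc _ ≤ ∫⁻ y in annulus n a b, ENNReal.ofReal a⁻¹ ^ n * (‖homogExt Ω y‖ₑ * ‖h y‖ₑ) := by
        refine setLIntegral_mono' (measurableSet_annulus a b) fun y hy => ?_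
        rw [enorm_mul, ← mul_assoc, div_eq_inv_mul, enorm_mul]
        gcongr
        rw [← ofReal_norm, norm_inv, norm_pow, norm_norm, ← inv_pow,
          ENNReal.ofReal_pow (by positivity)]
        gcongr
        exact hy.1.le
    _ = ENNReal.ofReal a⁻¹ ^ n * ∫⁻ y in annulus n a b, ‖homogExt Ω y‖ₑ * ‖h y‖ₑ :=
        lintegral_const_mul' _ _ (by finiteness)
    _ ≤ ENNReal.ofReal a⁻¹ ^ n * ∫⁻ y in Metric.ball 0 b, ‖homogExt Ω y‖ₑ * ‖h y‖ₑ := by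
        gcongr
        exact annulus_subset_ball a b
    _ ≤ ENNReal.ofReal a⁻¹ ^ n * ((∫⁻ y in Metric.ball 0 b, ‖homogExt Ω y‖ₑ ^ ρ) ^ (1 / ρ) *
          (∫⁻ y in Metric.ball 0 b, ‖h y‖ₑ ^ ρ') ^ (1 / ρ')) := by
        gcongr
        exact ENNReal.lintegral_mul_le_Lp_mul_Lq _ hρ hm.restrict.enorm hh.enorm
    _ ≤ _ := by
        rw [e1, e2, ← mul_assoc]
        gcongr
        refine (ENNReal.rpow_le_rpow (lintegral_ball_homogExt hn hΩ ρ hb)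
          (by have := hρ.pos; positivity)).trans (le_of_eq ?_)
        rw [ENNReal.mul_rpow_of_nonneg _ _ (by have := hρ.pos; positivity), ← ENNReal.rpow_natCast,
          ← ENNReal.rpow_mul]
        congr 2
        ring

end Polar

/-! ### The estimate on a single annulus. -/

/-- The Sobolev–Poincaré inequality with the exponents dual to the integrability of the kernel. -/
theorem exists_sobolevPoincare_rough {n : ℕ} (hn : 0 < n) {ρ ρ' α : ℝ}
    (hρ : ρ.HolderConjugate ρ') (hρn : ρ < n) (hα : ρ * n / (ρ * n + ρ - n) ≤ α) :
    ∃ C : ℝ≥0, ∀ (f : Eucl n → ℝ) (g : Eucl n → Eucl n), HasWeakGradient f g →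
      ∀ (x : Eucl n) (r : ℝ), 0 < r →
      ∃ c : ℝ, eLpNorm (fun y => f y - c) (ENNReal.ofReal ρ') (volume.restrict (Metric.ball x r)) ≤
        C * ENNReal.ofReal r ^ (n - n / ρ + 1 - n / α) *
          (∫⁻ y in Metric.ball x (3 * r), ‖g y‖ₑ ^ α) ^ (1 / α) := by
  have hρ1 : 1 < ρ := hρ.lt
  have hn' : (0 : ℝ) < n := by exact_mod_cast hn
  have hn1 : (1 : ℝ) ≤ n := by exact_mod_cast hn
  have hden : 0 < ρ * n + ρ - n := by nlinarith
  set p := ρ * n / (ρ * n + ρ - n) with hp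
  have hp1 : 1 ≤ p := by rw [hp, le_div_iff₀ hden]; linarith
  have hp0 : 0 < p := by linarith
  have hα0 : 0 < α := by linarith
  -- Hence 1/p - 1/n = 1/ρ': the Sobolev conjugate of p is ρ'. Hölder's inequality on the ball then
  -- raises p to α at the cost of the volume to the power k.
  have hpinv : p⁻¹ = 1 - ρ⁻¹ + (n : ℝ)⁻¹ := by
    rw [hp]; field_simp; ring
  have hρ'inv : ρ'⁻¹ = 1 - ρ⁻¹ := by rw [hρ.one_sub_inv]
  obtain ⟨C, hC⟩ := exists_sobolevPoincare hn (p := p.toNNReal) (p' := ρ'.toNNReal)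
    (by simpa using hp1) (by simpa using hρ.symm.lt.le) (by
      rw [Real.coe_toNNReal _ hp0.le, Real.coe_toNNReal _ hρ.symm.nonneg, hpinv, hρ'inv]; ring)
  set k : ℝ := 1 / p - 1 / α with hk
  have hk0 : 0 ≤ k := sub_nonneg.2 (one_div_le_one_div_of_le hp0 hα)
  set V : ℝ≥0∞ := ENNReal.ofReal 3 ^ n * volume (Metric.ball (0 : Eucl n) 1) with hV
  have hVt : V ≠ ⊤ := ENNReal.mul_ne_top (by finiteness) (volume_ball_ne_top _)
  have hVk : V ^ k ≠ ⊤ := by finiteness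
  refine ⟨C * (V ^ k).toNNReal, fun f g h x r hr => ?_⟩
  obtain ⟨c, hc⟩ := hC f g h x r hr
  refine ⟨c, hc.trans ?_⟩
  have h1 := eLpNorm_le_eLpNorm_mul_rpow_measure_univ
    (μ := volume.restrict (Metric.ball x (3 * r))) (ENNReal.ofReal_le_ofReal hα)
    (h.2.1.aestronglyMeasurable.restrict)
  rw [ENNReal.toReal_ofReal hp0.le, ENNReal.toReal_ofReal hα0.le, ← hk,
    eLpNorm_eq_lintegral_rpow_enorm_toReal (p := ENNReal.ofReal α) (by simpa using hα0)
      ENNReal.ofReal_ne_top, ENNReal.toReal_ofReal hα0.le, Measure.restrict_apply_univ] at h1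
  have h2 : volume (Metric.ball x (3 * r)) = ENNReal.ofReal r ^ n * V := by
    rw [volume_ball_mul x 0 (by norm_num), ← mul_one r, volume_ball_mul 0 0 hr, hV, mul_one]
    ring
  have h3 : volume (Metric.ball x (3 * r)) ^ k =
      ENNReal.ofReal r ^ (n - n / ρ + 1 - n / α) * V ^ k := by
    rw [h2, ENNReal.mul_rpow_of_nonneg _ _ hk0, ← ENNReal.rpow_natCast, ← ENNReal.rpow_mul]
    congr 2
    rw [hk, one_div, one_div, hpinv]
    field_simp
  rw [h3] at h1
  refine (mul_le_mul' le_rfl h1).trans (le_of_eq ?_)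
  push_cast
  rw [ENNReal.coe_toNNReal hVk]
  ring

section Shell

variable {n : ℕ} {Ω : UnitSph n → ℝ} {f : Eucl n → ℝ} {x : Eucl n}

theorem eLpNorm_comp_sub_left (x : Eucl n) (b : ℝ) {h : Eucl n → ℝ} (p : ℝ≥0∞)
    (hh : AEStronglyMeasurable h (volume.restrict (Metric.ball x b))) :
    AEStronglyMeasurable (fun y => h (x - y)) (volume.restrict (Metric.ball 0 b)) ∧
    eLpNorm (fun y => h (x - y)) p (volume.restrict (Metric.ball 0 b)) =
      eLpNorm h p (volume.restrict (Metric.ball x b)) := by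
  have h1 := (Measure.measurePreserving_sub_left (volume : Measure (Eucl n)) x).restrict_preimage
    (Metric.isOpen_ball (x := x) (ε := b)).measurableSet
  have h2 : (fun y => x - y) ⁻¹' Metric.ball x b = Metric.ball 0 b := by
    ext y; simp [dist_eq_norm]
  rw [h2] at h1
  exact ⟨hh.comp_measurePreserving h1, eLpNorm_comp_measurePreserving hh h1⟩

theorem aestronglyMeasurable_roughKernel (hn : n ≠ 0)
    (hΩ : AEStronglyMeasurable Ω (surfaceMeasure n)) :
    AEStronglyMeasurable (fun y : Eucl n => homogExt Ω y / ‖y‖ ^ n) volume := by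
  have h1 : Measurable fun y : Eucl n => (‖y‖ ^ n)⁻¹ := by fun_prop
  simp_rw [div_eq_mul_inv]
  exact (aestronglyMeasurable_homogExt hn hΩ).mul h1.aestronglyMeasurable

theorem truncRough_add (hn : n ≠ 0)
    (hint : ∀ ε R : ℝ, 0 < ε → IntegrableOn (roughIntegrand Ω f x) (annulus n ε R) volume)
    {a b c : ℝ} (ha : 0 < a) (hab : a < b) (hbc : b < c) :
    truncRough Ω f x a c = truncRough Ω f x a b + truncRough Ω f x b c := by
  have hae : annulus n a c =ᵐ[volume] (annulus n a b ∪ annulus n b c : Set (Eucl n)) := by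
    have : Nonempty (Fin n) := ⟨⟨0, Nat.pos_of_ne_zero hn⟩⟩
    have hs : volume (Metric.sphere (0 : Eucl n) b) = 0 := Measure.addHaar_sphere _ _ _
    filter_upwards [measure_eq_zero_iff_ae_notMem.1 hs] with y hy
    rw [mem_sphere_zero_iff_norm] at hy
    refine propext ?_
    show (a < ‖y‖ ∧ ‖y‖ < c) ↔ (a < ‖y‖ ∧ ‖y‖ < b) ∨ (b < ‖y‖ ∧ ‖y‖ < c)
    constructor
    · rintro ⟨h1, h2⟩
      rcases lt_or_gt_of_ne hy with h | h
      · exact Or.inl ⟨h1, h⟩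
      · exact Or.inr ⟨h, h2⟩
    · rintro (⟨h1, h2⟩ | ⟨h1, h2⟩)
      · exact ⟨h1, h2.trans hbc⟩
      · exact ⟨hab.trans h1, h2⟩
  rw [truncRough, setIntegral_congr_set hae, setIntegral_union _ (measurableSet_annulus _ _)
    (hint _ _ ha) (hint _ _ (ha.trans hab))]
  · rfl
  · rw [Set.disjoint_left]
    intro y h1 h2
    exact lt_asymm h1.2 h2.1

/-- Absolute convergence over annuli, and the bound over an annulus of comparable radii. -/
theorem exists_truncRough_le (hn : 0 < n) {ρ ρ' α : ℝ}
    (hρ : ρ.HolderConjugate ρ') (hρn : ρ < n) (hα : ρ * n / (ρ * n + ρ - n) ≤ α) :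
    ∃ C : ℝ≥0, ∀ Ω : UnitSph n → ℝ, MemLp Ω (ENNReal.ofReal ρ) (surfaceMeasure n) →
      ∫ θ, Ω θ ∂surfaceMeasure n = 0 →
      ∀ (f : Eucl n → ℝ) (g : Eucl n → Eucl n), HasWeakGradient f g →
      (∀ x r, ∫⁻ y in Metric.ball x r, ‖g y‖ₑ ^ α ≠ ⊤) → ∀ x : Eucl n,
      (∀ ε R : ℝ, 0 < ε → IntegrableOn (roughIntegrand Ω f x) (annulus n ε R) volume) ∧
      ∀ a b : ℝ, 0 < a → a < b → b ≤ 2 * a →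
        ‖truncRough Ω f x a b‖ₑ ≤ C * eLpNorm Ω (ENNReal.ofReal ρ) (surfaceMeasure n) *
          ENNReal.ofReal b ^ (1 - n / α) *
          (∫⁻ y in Metric.ball x (3 * b), ‖g y‖ₑ ^ α) ^ (1 / α) := by
  have hn0 : n ≠ 0 := hn.ne'
  have hρ1 : 1 < ρ := hρ.lt
  have hn' : (0 : ℝ) < n := by exact_mod_cast hn
  have hα0 : 0 < α := by
    have hden : 0 < ρ * n + ρ - n := by nlinarith
    have : 0 < ρ * n / (ρ * n + ρ - n) := by positivity
    linarith
  obtain ⟨C, hC⟩ := exists_sobolevPoincare_rough hn hρ hρn hα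
  refine ⟨2 ^ n * C, fun Ω hΩ hΩ0 f g h hloc x => ?_⟩
  have hΩm := hΩ.1
  have hΩt : eLpNorm Ω (ENNReal.ofReal ρ) (surfaceMeasure n) ≠ ⊤ := hΩ.2.ne
  have hfx : ∀ b, 0 < b → ∃ c : ℝ,
      AEStronglyMeasurable (fun y => f (x - y) - c) (volume.restrict (Metric.ball 0 b)) ∧
      eLpNorm (fun y => f (x - y) - c) (ENNReal.ofReal ρ') (volume.restrict (Metric.ball 0 b)) ≤
        C * ENNReal.ofReal b ^ (n - n / ρ + 1 - n / α) *
          (∫⁻ y in Metric.ball x (3 * b), ‖g y‖ₑ ^ α) ^ (1 / α) := by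
    intro b hb
    obtain ⟨c, hc⟩ := hC f g h x b hb
    have hm : AEStronglyMeasurable (fun y => f y - c) (volume.restrict (Metric.ball x b)) :=
      h.1.aestronglyMeasurable.restrict.sub aestronglyMeasurable_const
    obtain ⟨h1, h2⟩ := eLpNorm_comp_sub_left x b (ENNReal.ofReal ρ') hm
    exact ⟨c, h1, h2.le.trans hc⟩
  have hker := aestronglyMeasurable_roughKernel hn0 hΩm
  have hkint : ∀ (ε R : ℝ), 0 < ε → 0 < R → ∀ u : Eucl n → ℝ,
      AEStronglyMeasurable u (volume.restrict (Metric.ball 0 R)) →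
      eLpNorm u (ENNReal.ofReal ρ') (volume.restrict (Metric.ball 0 R)) ≠ ⊤ →
      IntegrableOn (fun y => homogExt Ω y / ‖y‖ ^ n * u y) (annulus n ε R) volume := by
    intro ε R hε hR u hu hut
    refine ⟨hker.restrict.mul (hu.mono_measure
      (Measure.restrict_mono (annulus_subset_ball ε R) le_rfl)), ?_⟩
    refine (lintegral_annulus_homogExt_mul_le hn0 hρ hΩm hε hR hu).trans_lt ?_
    have h1 : ENNReal.ofReal R ^ ((n : ℝ) / ρ) ≠ ⊤ :=
      ENNReal.rpow_ne_top_of_nonneg (by positivity) ENNReal.ofReal_ne_top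
    finiteness
  have hint2 : ∀ (ε R c : ℝ), 0 < ε → 0 < R → IntegrableOn (fun y : Eucl n => homogExt Ω y / ‖y‖ ^ n * c)
      (annulus n ε R) volume := by
    intro ε R c hε hR
    have hfin : IsFiniteMeasure (volume.restrict (Metric.ball (0 : Eucl n) R)) :=
      ⟨by rw [Measure.restrict_apply_univ]; exact measure_ball_lt_top⟩
    refine hkint ε R hε hR (fun _ => c) aestronglyMeasurable_const ?_
    exact (memLp_const c).2.ne
  have hint1 : ∀ (ε R : ℝ), 0 < ε → 0 < R → ∃ c : ℝ,
      IntegrableOn (fun y : Eucl n => homogExt Ω y / ‖y‖ ^ n * (f (x - y) - c)) (annulus n ε R) volume ∧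
      ∫⁻ y in annulus n ε R, ‖homogExt Ω y / ‖y‖ ^ n * (f (x - y) - c)‖ₑ ≤
        ENNReal.ofReal ε⁻¹ ^ n * (ENNReal.ofReal R ^ (n / ρ) *
        eLpNorm Ω (ENNReal.ofReal ρ) (surfaceMeasure n)) *
        (C * ENNReal.ofReal R ^ (n - n / ρ + 1 - n / α) *
          (∫⁻ y in Metric.ball x (3 * R), ‖g y‖ₑ ^ α) ^ (1 / α)) := by
    intro ε R hε hR
    obtain ⟨c, hm, hc⟩ := hfx R hR
    refine ⟨c, hkint ε R hε hR _ hm (ne_top_of_le_ne_top ?_ hc), ?_⟩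
    · have h1 : ENNReal.ofReal R ^ ((n : ℝ) - n / ρ + 1 - n / α) ≠ ⊤ := by
        rw [ENNReal.ofReal_rpow_of_pos hR]; exact ENNReal.ofReal_ne_top
      have h2 := ENNReal.rpow_ne_top_of_nonneg (y := 1 / α) (by positivity) (hloc x (3 * R))
      finiteness
    · refine (lintegral_annulus_homogExt_mul_le hn0 hρ hΩm hε hR hm).trans ?_
      gcongr
  have hint : ∀ ε R : ℝ, 0 < ε → IntegrableOn (roughIntegrand Ω f x) (annulus n ε R) volume := by
    intro ε R hε
    rcases le_or_gt R 0 with hR | hR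
    · have : annulus n ε R = ∅ := eq_empty_of_forall_notMem fun y hy =>
        absurd (hy.1.trans hy.2) (not_lt.2 (hR.trans hε.le))
      rw [this]; exact integrableOn_empty
    obtain ⟨c, hc, -⟩ := hint1 ε R hε hR
    refine (hc.add (hint2 ε R c hε hR)).congr (Eventually.of_forall fun y => ?_)
    simp only [Pi.add_apply, roughIntegrand]
    ring
  refine ⟨hint, fun a b ha hab hba => ?_⟩
  have hb : 0 < b := ha.trans hab
  obtain ⟨c, hc, hle⟩ := hint1 a b ha hb
  -- Mean zero lets the Sobolev–Poincaré constant be subtracted from f without changing the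
  -- integral.
  have e : truncRough Ω f x a b =
      ∫ y in annulus n a b, homogExt Ω y / ‖y‖ ^ n * (f (x - y) - c) := by
    have h1 : truncRough Ω f x a b =
        ∫ y in annulus n a b, (homogExt Ω y / ‖y‖ ^ n * (f (x - y) - c) +
          homogExt Ω y / ‖y‖ ^ n * c) := by
      refine integral_congr_ae (Eventually.of_forall fun y => ?_)
      simp only [roughIntegrand]; ring
    rw [h1, integral_add hc (hint2 a b c ha hb), integral_mul_const,
      integral_annulus_homogExt_eq_zero hn0 hΩ0, zero_mul, add_zero]
  rw [e]
  refine (enorm_integral_le_lintegral_enorm _).trans (hle.trans ?_)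
  set W := eLpNorm Ω (ENNReal.ofReal ρ) (surfaceMeasure n)
  set E := (∫⁻ y in Metric.ball x (3 * b), ‖g y‖ₑ ^ α) ^ (1 / α)
  have hB0 : ENNReal.ofReal b ≠ 0 := by simpa using hb
  have hBt : ENNReal.ofReal b ≠ ⊤ := ENNReal.ofReal_ne_top
  have h1 : ENNReal.ofReal a⁻¹ ^ n ≤ 2 ^ n * ENNReal.ofReal b ^ (-(n : ℝ)) := by
    have h2 : ENNReal.ofReal a⁻¹ ≤ 2 * ENNReal.ofReal b⁻¹ := by
      rw [show (2 : ℝ≥0∞) = ENNReal.ofReal 2 by simp, ← ENNReal.ofReal_mul (by norm_num)]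
      refine ENNReal.ofReal_le_ofReal ?_
      rw [← div_eq_mul_inv, le_div_iff₀ hb, inv_mul_le_iff₀ ha]
      linarith
    refine (pow_le_pow_left' h2 n).trans (le_of_eq ?_)
    rw [mul_pow, ENNReal.rpow_neg, ENNReal.rpow_natCast, ENNReal.ofReal_inv_of_pos hb,
      ENNReal.inv_pow]
  have h3 : ENNReal.ofReal b ^ (-(n : ℝ)) * ENNReal.ofReal b ^ ((n : ℝ) / ρ) *
      ENNReal.ofReal b ^ ((n : ℝ) - n / ρ + 1 - n / α) = ENNReal.ofReal b ^ (1 - n / α) := by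
    rw [← ENNReal.rpow_add _ _ hB0 hBt, ← ENNReal.rpow_add _ _ hB0 hBt]
    congr 1; ring
  calc _ ≤ (2 ^ n * ENNReal.ofReal b ^ (-(n : ℝ))) * (ENNReal.ofReal b ^ ((n : ℝ) / ρ) * W) *
        (C * ENNReal.ofReal b ^ ((n : ℝ) - n / ρ + 1 - n / α) * E) := by gcongr
    _ = 2 ^ n * C * W * (ENNReal.ofReal b ^ (-(n : ℝ)) * ENNReal.ofReal b ^ ((n : ℝ) / ρ) *
      ENNReal.ofReal b ^ ((n : ℝ) - n / ρ + 1 - n / α)) * E := by ring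
    _ = _ := by rw [h3]; push_cast; rfl

end Shell

/-! ### Summation over dyadic annuli. -/

section Annuli

variable {S : ℝ → ℝ → ℝ} {P Q γ : ℝ}

/-- Peel off the outermost annulus (b/2, b) repeatedly; the bounds P b, P b/2, ... sum to at most 2
P b, whatever a is. -/
theorem abs_le_of_dyadic_near
    (hadd : ∀ a b c, 0 < a → a < b → b < c → S a c = S a b + S b c) (hP : 0 ≤ P)
    (hSP : ∀ a b, 0 < a → a < b → b ≤ 2 * a → |S a b| ≤ P * b) {a b : ℝ} (ha : 0 < a)
    (hab : a < b) : |S a b| ≤ 2 * P * b := by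
  have key : ∀ (k : ℕ) (b : ℝ), a < b → b ≤ 2 ^ k * a → |S a b| ≤ 2 * P * b := by
    intro k
    induction k with
    | zero => intro b h1 h2; simp at h2; linarith
    | succ k ih =>
      intro b h1 h2
      have hPb : 0 ≤ P * b := mul_nonneg hP (ha.trans h1).le
      rcases le_or_gt b (2 * a) with h3 | h3
      · have := hSP a b ha h1 h3
        linarith
      · have h4 : a < b / 2 := by linarith
        have h5 := ih (b / 2) h4 (by rw [pow_succ] at h2; linarith)
        have h6 := hSP (b / 2) b (by linarith) (by linarith) (by linarith)
        rw [hadd a (b / 2) b ha h4 (by linarith)]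
        have := abs_add_le (S a (b / 2)) (S (b / 2) b)
        linarith
  obtain ⟨k, hk⟩ := pow_unbounded_of_one_lt (b / a) one_lt_two
  exact key k b hab (by rw [div_lt_iff₀ ha] at hk; exact hk.le)

/-- Peel off the innermost annulus (a, 2a) repeatedly. The constant is the sum of the geometric
series of ratio 2^(-γ), that is, the fixed point in `hDeq` which closes the induction. -/
theorem abs_le_of_dyadic_far
    (hadd : ∀ a b c, 0 < a → a < b → b < c → S a c = S a b + S b c) (hQ : 0 ≤ Q) (hγ : 0 < γ)
    (hSQ : ∀ a b, 0 < a → a < b → b ≤ 2 * a → |S a b| ≤ Q * b ^ (-γ)) {a b : ℝ} (ha : 0 < a)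
    (hab : a < b) : |S a b| ≤ (1 - 2 ^ (-γ))⁻¹ * Q * a ^ (-γ) := by
  have hlt : (2 : ℝ) ^ (-γ) < 1 := Real.rpow_lt_one_of_one_lt_of_neg one_lt_two (by linarith)
  have hpos : (0 : ℝ) < 2 ^ (-γ) := by positivity
  set D : ℝ := (1 - 2 ^ (-γ))⁻¹ with hD
  have hDeq : 1 + D * 2 ^ (-γ) = D := by
    have : 1 - (2 : ℝ) ^ (-γ) ≠ 0 := by linarith
    rw [hD]; field_simp; ring
  have hD1 : 1 ≤ D := by
    have : 0 < D := inv_pos.2 (by linarith)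
    nlinarith [mul_pos this hpos]
  have hbase : ∀ a b, 0 < a → a < b → b ≤ 2 * a → |S a b| ≤ Q * a ^ (-γ) := by
    intro a b h1 h2 h3
    refine (hSQ a b h1 h2 h3).trans (mul_le_mul_of_nonneg_left ?_ hQ)
    exact Real.rpow_le_rpow_of_nonpos h1 h2.le (by linarith)
  have key : ∀ (k : ℕ) (a : ℝ), 0 < a → a < b → b ≤ 2 ^ k * a → |S a b| ≤ D * Q * a ^ (-γ) := by
    intro k
    induction k with
    | zero => intro a h0 h1 h2; simp at h2; linarith
    | succ k ih =>
      intro a h0 h1 h2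
      have hQa : 0 ≤ Q * a ^ (-γ) := by positivity
      rcases le_or_gt b (2 * a) with h3 | h3
      · have := hbase a b h0 h1 h3
        nlinarith
      · have h5 := ih (2 * a) (by linarith) h3 (by rw [pow_succ] at h2; linarith)
        have h6 := hbase a (2 * a) h0 (by linarith) le_rfl
        rw [hadd a (2 * a) b h0 (by linarith) h3]
        rw [Real.mul_rpow (by norm_num) h0.le] at h5
        refine (abs_add_le _ _).trans ((add_le_add h6 h5).trans (le_of_eq ?_))
        calc _ = (1 + D * 2 ^ (-γ)) * (Q * a ^ (-γ)) := by ring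
          _ = _ := by rw [hDeq]; ring
  obtain ⟨k, hk⟩ := pow_unbounded_of_one_lt (b / a) one_lt_two
  exact key k a ha hab (by rw [div_lt_iff₀ ha] at hk; exact hk.le)

/-- The near bound gives the Cauchy property as the inner radius tends to 0, the far bound as the
outer one tends to infinity. Joining the two limits at radius 1 gives L; splitting at an arbitrary t
bounds it. -/
theorem exists_tendsto_of_dyadic_bounds
    (hadd : ∀ a b c, 0 < a → a < b → b < c → S a c = S a b + S b c) (hP : 0 ≤ P) (hQ : 0 ≤ Q)
    (hγ : 0 < γ)
    (hSP : ∀ a b, 0 < a → a < b → b ≤ 2 * a → |S a b| ≤ P * b)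
    (hSQ : ∀ a b, 0 < a → a < b → b ≤ 2 * a → |S a b| ≤ Q * b ^ (-γ)) :
    ∃ L, Tendsto (fun q : ℝ × ℝ => S q.1 q.2) (𝓝[>] (0 : ℝ) ×ˢ atTop) (𝓝 L) ∧
      ∀ t, 0 < t → |L| ≤ 2 * P * t + (1 - 2 ^ (-γ))⁻¹ * Q * t ^ (-γ) := by
  set D : ℝ := (1 - 2 ^ (-γ))⁻¹ with hD
  have near : ∀ {a b}, 0 < a → a < b → |S a b| ≤ 2 * P * b := fun ha hab =>
    abs_le_of_dyadic_near hadd hP hSP ha hab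
  have far : ∀ {a b}, 0 < a → a < b → |S a b| ≤ D * Q * a ^ (-γ) := fun ha hab =>
    abs_le_of_dyadic_far hadd hQ hγ hSQ ha hab
  have hA : ∃ LA, Tendsto (fun a => S a 1) (𝓝[>] 0) (𝓝 LA) := by
    refine cauchy_map_iff_exists_tendsto.1 (Metric.cauchy_iff.2 ⟨inferInstance, fun ε hε => ?_⟩)
    have h0 : Tendsto (fun t : ℝ => 2 * P * t) (𝓝[>] 0) (𝓝 0) := by
      have : Tendsto (fun t : ℝ => 2 * P * t) (𝓝 0) (𝓝 (2 * P * 0)) :=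
        (continuous_const.mul continuous_id).tendsto 0
      rw [mul_zero] at this
      exact this.mono_left nhdsWithin_le_nhds
    obtain ⟨δ, hδ, hδ0, hδ1⟩ := ((h0.eventually (gt_mem_nhds hε)).and
      (Ioo_mem_nhdsGT one_pos)).exists
    refine ⟨(fun a => S a 1) '' Ioo 0 δ, image_mem_map (Ioo_mem_nhdsGT hδ0), ?_⟩
    have key : ∀ a b, a ∈ Ioo 0 δ → b ∈ Ioo 0 δ → a < b → dist (S a 1) (S b 1) < ε := by
      intro a b ha hb hab
      rw [hadd a b 1 ha.1 hab (hb.2.trans hδ1), Real.dist_eq, add_sub_cancel_right]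
      refine (near ha.1 hab).trans_lt (lt_of_le_of_lt ?_ hδ)
      exact mul_le_mul_of_nonneg_left hb.2.le (by positivity)
    rintro _ ⟨a, ha, rfl⟩ _ ⟨b, hb, rfl⟩
    rcases lt_trichotomy a b with h | rfl | h
    · exact key a b ha hb h
    · simpa using hε
    · rw [dist_comm]; exact key b a hb ha h
  have hG : ∃ LG, Tendsto (fun R => S 1 R) atTop (𝓝 LG) := by
    refine cauchy_map_iff_exists_tendsto.1 (Metric.cauchy_iff.2 ⟨inferInstance, fun ε hε => ?_⟩)
    have h0 : Tendsto (fun t : ℝ => D * Q * t ^ (-γ)) atTop (𝓝 0) := by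
      have := (tendsto_rpow_neg_atTop hγ).const_mul (D * Q)
      rwa [mul_zero] at this
    obtain ⟨δ, hδ, hδ1⟩ := ((h0.eventually (gt_mem_nhds hε)).and
      (eventually_gt_atTop 1)).exists
    refine ⟨(fun R => S 1 R) '' Ioi δ, image_mem_map (Ioi_mem_atTop δ), ?_⟩
    have hδ0 : 0 < δ := by linarith
    have key : ∀ a b, a ∈ Ioi δ → b ∈ Ioi δ → a < b → dist (S 1 b) (S 1 a) < ε := by
      intro a b ha hb hab
      rw [mem_Ioi] at ha hb
      rw [hadd 1 a b one_pos (hδ1.trans ha) hab, Real.dist_eq, add_sub_cancel_left]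
      refine (far (hδ0.trans ha) hab).trans_lt (lt_of_le_of_lt ?_ hδ)
      have hD0 : 0 ≤ D := by
        refine inv_nonneg.2 (sub_nonneg.2 ?_)
        exact (Real.rpow_lt_one_of_one_lt_of_neg one_lt_two (by linarith)).le
      exact mul_le_mul_of_nonneg_left
        (Real.rpow_le_rpow_of_nonpos hδ0 ha.le (by linarith)) (by positivity)
    rintro _ ⟨a, ha, rfl⟩ _ ⟨b, hb, rfl⟩
    rcases lt_trichotomy a b with h | rfl | h
    · rw [dist_comm]; exact key a b ha hb h
    · simpa using hε
    · exact key b a hb ha h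
  obtain ⟨LA, hLA⟩ := hA
  obtain ⟨LG, hLG⟩ := hG
  have hsplit : ∀ t, 0 < t → ∀ᶠ q : ℝ × ℝ in 𝓝[>] (0 : ℝ) ×ˢ atTop,
      0 < q.1 ∧ q.1 < t ∧ t < q.2 := by
    intro t ht
    have h1 : ∀ᶠ a in 𝓝[>] (0 : ℝ), a ∈ Ioo 0 t := Ioo_mem_nhdsGT ht
    filter_upwards [h1.prod_mk (eventually_gt_atTop t)] with q hq
    exact ⟨hq.1.1, hq.1.2, hq.2⟩
  have hlim : Tendsto (fun q : ℝ × ℝ => S q.1 q.2) (𝓝[>] (0 : ℝ) ×ˢ atTop) (𝓝 (LA + LG)) := by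
    refine ((hLA.comp tendsto_fst).add (hLG.comp tendsto_snd)).congr' ?_
    filter_upwards [hsplit 1 one_pos] with q hq
    exact (hadd q.1 1 q.2 hq.1 hq.2.1 hq.2.2).symm
  refine ⟨LA + LG, hlim, fun t ht => le_of_tendsto hlim.abs ?_⟩
  filter_upwards [hsplit t ht] with q hq
  rw [hadd q.1 t q.2 hq.1 hq.2.1 hq.2.2]
  exact (abs_add_le _ _).trans (add_le_add (near hq.1 hq.2.1) (far ht hq.2.2))

end Annuli

/-! ### The pointwise bound for the principal value. -/

theorem le_rpow_mul_rpow_of_forall_le {l P Q D θ : ℝ} (hP : 0 ≤ P) (hQ : 0 ≤ Q) (hD : 0 ≤ D)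
    (hθ0 : 0 < θ) (hθ1 : θ < 1)
    (h : ∀ t, 0 < t → l ≤ 2 * P * t + D * Q * t ^ (-(1 / θ - 1))) :
    l ≤ (2 + D) * (P ^ (1 - θ) * Q ^ θ) := by
  -- The choice t = (Q/P)^θ balances the two terms. Shifting P and Q by δ avoids a vanishing
  -- numerator or denominator; δ tends to 0 at the end.
  have key : ∀ δ, 0 < δ → l ≤ (2 + D) * ((P + δ) ^ (1 - θ) * (Q + δ) ^ θ) := by
    intro δ hδ
    have hp : 0 < P + δ := by linarith
    have hq : 0 < Q + δ := by linarith
    set t := ((Q + δ) / (P + δ)) ^ θ with ht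
    have ht0 : 0 < t := by positivity
    have e1 : (P + δ) * t = (P + δ) ^ (1 - θ) * (Q + δ) ^ θ := by
      rw [ht, Real.div_rpow hq.le hp.le, Real.rpow_sub hp, Real.rpow_one]
      field_simp
    have e2 : (Q + δ) * t ^ (-(1 / θ - 1)) = (P + δ) ^ (1 - θ) * (Q + δ) ^ θ := by
      rw [ht, ← Real.rpow_mul (by positivity),
        show θ * -(1 / θ - 1) = -(1 - θ) by field_simp,
        Real.rpow_neg (by positivity), Real.div_rpow hq.le hp.le, inv_div]
      have : (Q + δ) ^ θ * (Q + δ) ^ (1 - θ) = Q + δ := by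
        rw [← Real.rpow_add hq, add_sub_cancel, Real.rpow_one]
      have h3 : 0 < (Q + δ) ^ (1 - θ) := by positivity
      field_simp
      linarith
    calc l ≤ 2 * P * t + D * Q * t ^ (-(1 / θ - 1)) := h t ht0
      _ ≤ 2 * (P + δ) * t + D * (Q + δ) * t ^ (-(1 / θ - 1)) := by
          gcongr <;> linarith
      _ = 2 * ((P + δ) * t) + D * ((Q + δ) * t ^ (-(1 / θ - 1))) := by ring
      _ = _ := by rw [e1, e2]; ring
  have hc : Tendsto (fun δ : ℝ => (2 + D) * ((P + δ) ^ (1 - θ) * (Q + δ) ^ θ)) (𝓝[>] 0)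
      (𝓝 ((2 + D) * (P ^ (1 - θ) * Q ^ θ))) := by
    have hcont : Continuous fun δ : ℝ => (2 + D) * ((P + δ) ^ (1 - θ) * (Q + δ) ^ θ) := by
      refine continuous_const.mul (Continuous.mul ?_ ?_)
      · exact (continuous_const.add continuous_id).rpow_const fun _ => Or.inr (by linarith)
      · exact (continuous_const.add continuous_id).rpow_const fun _ => Or.inr hθ0.le
    have := hcont.tendsto 0
    simp only [add_zero] at this
    exact this.mono_left nhdsWithin_le_nhds
  refine ge_of_tendsto hc ?_
  filter_upwards [self_mem_nhdsWithin] with δ hδ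
  exact key δ hδ

/-- With second Morrey exponent αn/β, the scaling power n(1 - a/b) is n - β. -/
theorem lintegral_ball_le_morreyNorm {n : ℕ} (hn : 0 < n) {F : Type*} [NormedAddCommGroup F]
    {α β : ℝ} (hα : 0 < α) (g : Eucl n → F) (x : Eucl n) {r : ℝ} (hr : 0 < r) :
    ∫⁻ y in Metric.ball x r, ‖g y‖ₑ ^ α ≤
      ENNReal.ofReal r ^ (n - β) * morreyNorm α (α * n / β) g ^ α := by
  have hn' : (0 : ℝ) < n := by exact_mod_cast hn
  have h1 : (ENNReal.ofReal (r ^ (-((n : ℝ) * (1 - α / (α * n / β))))) *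
      ∫⁻ y in Metric.ball x r, ‖g y‖ₑ ^ α) ^ (1 / α) ≤ morreyNorm α (α * n / β) g :=
    le_iSup_of_le x (le_iSup₂_of_le r hr le_rfl)
  have e : -((n : ℝ) * (1 - α / (α * n / β))) = -(n - β) := by
    rw [div_div_eq_mul_div, mul_div_mul_left _ _ hα.ne']; field_simp
  rw [e, one_div, ENNReal.rpow_inv_le_iff hα, ← ENNReal.ofReal_rpow_of_pos hr,
    ENNReal.rpow_neg] at h1
  have h0 : ENNReal.ofReal r ^ (n - β) ≠ 0 := by
    simp [ENNReal.ofReal_rpow_of_pos hr, Real.rpow_pos_of_pos hr]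
  have ht : ENNReal.ofReal r ^ (n - β) ≠ ⊤ := by
    simp [ENNReal.ofReal_rpow_of_pos hr]
  rwa [← ENNReal.div_eq_inv_mul, ENNReal.div_le_iff_le_mul (Or.inl h0) (Or.inl ht), mul_comm] at h1

/-- Existence of the principal value and its pointwise bound by the maximal function. -/
theorem exists_roughPV_le {n : ℕ} (hn : 0 < n) {ρ ρ' α β : ℝ} (hρ : ρ.HolderConjugate ρ')
    (hρn : ρ < n) (hα : ρ * n / (ρ * n + ρ - n) ≤ α) (h1α : 1 < α) (hαβ : α < β) :
    ∃ C : ℝ≥0, ∀ Ω : UnitSph n → ℝ, MemLp Ω (ENNReal.ofReal ρ) (surfaceMeasure n) →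
      ∫ θ, Ω θ ∂surfaceMeasure n = 0 →
      ∀ (f : Eucl n → ℝ) (g : Eucl n → Eucl n), HasWeakGradient f g →
      morreyNorm α (α * n / β) g < ⊤ → ∀ x, hlMax (fun y => ‖g y‖ₑ ^ α) x < ⊤ →
      ∃ L, IsRoughPV Ω f x L ∧
        ‖L‖ₑ ≤ C * eLpNorm Ω (ENNReal.ofReal ρ) (surfaceMeasure n) *
          morreyNorm α (α * n / β) g ^ (α / β) *
          hlMax (fun y => ‖g y‖ₑ ^ α) x ^ ((1 - α / β) / α) := by
  have hα0 : 0 < α := by linarith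
  have hβ0 : 0 < β := by linarith
  set θ := α / β with hθ
  have hθ0 : 0 < θ := by positivity
  have hθ1 : θ < 1 := (div_lt_one hβ0).2 hαβ
  -- This is β/α - 1, the decay rate from the Morrey bound: b^(1-n/α) b^((n-β)/α) = b^(-γ).
  set γ := 1 / θ - 1 with hγ
  have hγ0 : 0 < γ := by rw [hγ, sub_pos, lt_div_iff₀ hθ0]; linarith
  have hθinv : 1 / θ = β / α := by rw [hθ, one_div_div]
  obtain ⟨C, hC⟩ := exists_truncRough_le hn hρ hρn hα
  set D : ℝ := (1 - 2 ^ (-γ))⁻¹ with hD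
  have hD0 : 0 ≤ D := by
    refine inv_nonneg.2 (sub_nonneg.2 ?_)
    exact (Real.rpow_lt_one_of_one_lt_of_neg one_lt_two (by linarith)).le
  set V₁ : ℝ≥0∞ := (ENNReal.ofReal 3 ^ n * volume (Metric.ball (0 : Eucl n) 1)) ^ (1 / α) with hV₁
  set V₂ : ℝ≥0∞ := (ENNReal.ofReal 3 ^ ((n : ℝ) - β)) ^ (1 / α) with hV₂
  have hV₁t : V₁ ≠ ⊤ := ENNReal.rpow_ne_top_of_nonneg (by positivity)
    (ENNReal.mul_ne_top (by finiteness) (volume_ball_ne_top _))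
  have hV₂t : V₂ ≠ ⊤ := by
    refine ENNReal.rpow_ne_top_of_nonneg (by positivity) ?_
    rw [ENNReal.ofReal_rpow_of_pos (by norm_num)]; exact ENNReal.ofReal_ne_top
  set A : ℝ≥0∞ := ENNReal.ofReal (2 + D) * (C * (V₁ ^ (1 - θ) * V₂ ^ θ)) with hA
  have hV₁θ : V₁ ^ (1 - θ) ≠ ⊤ := ENNReal.rpow_ne_top_of_nonneg (by linarith) hV₁t
  have hV₂θ : V₂ ^ θ ≠ ⊤ := ENNReal.rpow_ne_top_of_nonneg hθ0.le hV₂t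
  have hAt : A ≠ ⊤ := by finiteness
  refine ⟨A.toNNReal, fun Ω hΩ hΩ0 f g h hN x hM => ?_⟩
  rw [ENNReal.coe_toNNReal hAt]
  set W := eLpNorm Ω (ENNReal.ofReal ρ) (surfaceMeasure n) with hW
  have hWt : W ≠ ⊤ := hΩ.2.ne
  set N := morreyNorm α (α * n / β) g with hNdef
  set M := hlMax (fun y => ‖g y‖ₑ ^ α) x with hMdef
  have hNα : N ^ α ≠ ⊤ := ENNReal.rpow_ne_top_of_nonneg hα0.le hN.ne
  have hMα : M ^ (1 / α) ≠ ⊤ := ENNReal.rpow_ne_top_of_nonneg (by positivity) hM.ne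
  have hloc : ∀ x r, ∫⁻ y in Metric.ball x r, ‖g y‖ₑ ^ α ≠ ⊤ := by
    intro x r
    rcases le_or_gt r 0 with hr | hr
    · rw [Metric.ball_eq_empty.2 hr]; simp
    · refine ne_top_of_le_ne_top ?_ (lintegral_ball_le_morreyNorm (β := β) hn hα0 g x hr)
      rw [ENNReal.ofReal_rpow_of_pos hr]
      finiteness
  obtain ⟨hint, hS⟩ := hC Ω hΩ hΩ0 f g h hloc x
  set P : ℝ≥0∞ := C * W * V₁ * M ^ (1 / α) with hP
  set Q : ℝ≥0∞ := C * W * V₂ * N with hQ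
  have hPt : P ≠ ⊤ := by finiteness
  have hQt : Q ≠ ⊤ := by finiteness [hN.ne]
  have hSP : ∀ a b, 0 < a → a < b → b ≤ 2 * a → |truncRough Ω f x a b| ≤ P.toReal * b := by
    intro a b ha hab hba
    have hb : 0 < b := ha.trans hab
    have hB0 : ENNReal.ofReal b ≠ 0 := by simpa using hb
    have h1 : ‖truncRough Ω f x a b‖ₑ ≤ P * ENNReal.ofReal b := by
      refine (hS a b ha hab hba).trans ?_
      have h2 := lintegral_ball_le_hlMax (fun y => ‖g y‖ₑ ^ α) x (by linarith : 0 < 3 * b)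
      rw [volume_ball_mul x 0 (by norm_num), ← mul_one b, volume_ball_mul 0 0 hb, mul_one] at h2
      calc _ ≤ C * W * ENNReal.ofReal b ^ (1 - n / α) * (M * (ENNReal.ofReal 3 ^ n *
            (ENNReal.ofReal b ^ n * volume (Metric.ball (0 : Eucl n) 1)))) ^ (1 / α) := by
            gcongr
        _ = C * W * ENNReal.ofReal b ^ (1 - n / α) *
            ((ENNReal.ofReal 3 ^ n * volume (Metric.ball (0 : Eucl n) 1)) * M *
              ENNReal.ofReal b ^ n) ^ (1 / α) := by
            congr 2; ring
        _ = P * (ENNReal.ofReal b ^ (1 - n / α) * ENNReal.ofReal b ^ (n / α)) := by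
            rw [ENNReal.mul_rpow_of_nonneg _ _ (by positivity),
              ENNReal.mul_rpow_of_nonneg _ M (by positivity), ← hV₁, ← ENNReal.rpow_natCast,
              ← ENNReal.rpow_mul, mul_one_div, hP]
            ring
        _ = _ := by
            rw [← ENNReal.rpow_add _ _ hB0 ENNReal.ofReal_ne_top, sub_add_cancel,
              ENNReal.rpow_one]
    have h3 := ENNReal.toReal_mono (by finiteness) h1
    rwa [toReal_enorm, Real.norm_eq_abs, ENNReal.toReal_mul, ENNReal.toReal_ofReal hb.le] at h3
  have hSQ : ∀ a b, 0 < a → a < b → b ≤ 2 * a →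
      |truncRough Ω f x a b| ≤ Q.toReal * b ^ (-γ) := by
    intro a b ha hab hba
    have hb : 0 < b := ha.trans hab
    have hB0 : ENNReal.ofReal b ≠ 0 := by simpa using hb
    have h1 : ‖truncRough Ω f x a b‖ₑ ≤ Q * ENNReal.ofReal b ^ (-γ) := by
      refine (hS a b ha hab hba).trans ?_
      have h2 := lintegral_ball_le_morreyNorm (β := β) hn hα0 g x (by linarith : 0 < 3 * b)
      calc _ ≤ C * W * ENNReal.ofReal b ^ (1 - n / α) *
            (ENNReal.ofReal (3 * b) ^ (n - β) * N ^ α) ^ (1 / α) := by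
            gcongr
        _ = Q * (ENNReal.ofReal b ^ (1 - n / α) * ENNReal.ofReal b ^ ((n - β) * (1 / α))) := by
            rw [ENNReal.ofReal_mul (by norm_num), ENNReal.mul_rpow_of_nonneg _ _ (by positivity),
              ENNReal.mul_rpow_of_ne_zero (by simp) hB0,
              ENNReal.mul_rpow_of_nonneg _ _ (by positivity), ← hV₂, ← ENNReal.rpow_mul,
              ← ENNReal.rpow_mul, mul_one_div_cancel hα0.ne', ENNReal.rpow_one, hQ]
            ring
        _ = _ := by
            rw [← ENNReal.rpow_add _ _ hB0 ENNReal.ofReal_ne_top]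
            congr 2
            rw [hγ, hθinv]
            ring
    have h4 : ENNReal.ofReal b ^ (-γ) = ENNReal.ofReal (b ^ (-γ)) :=
      ENNReal.ofReal_rpow_of_pos hb
    rw [h4] at h1
    have h3 := ENNReal.toReal_mono (by finiteness) h1
    rwa [toReal_enorm, Real.norm_eq_abs, ENNReal.toReal_mul,
      ENNReal.toReal_ofReal (by positivity)] at h3
  obtain ⟨L, hL, hLle⟩ := exists_tendsto_of_dyadic_bounds
    (S := fun a b => truncRough Ω f x a b)
    (fun a b c ha hab hbc => truncRough_add hn.ne' hint ha hab hbc)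
    ENNReal.toReal_nonneg ENNReal.toReal_nonneg hγ0 hSP hSQ
  refine ⟨L, ⟨hint, hL⟩, ?_⟩
  have hLe := le_rpow_mul_rpow_of_forall_le ENNReal.toReal_nonneg ENNReal.toReal_nonneg hD0
    hθ0 hθ1 hLle
  have hPθ : P ^ (1 - θ) ≠ ⊤ := ENNReal.rpow_ne_top_of_nonneg (by linarith) hPt
  have hQθ : Q ^ θ ≠ ⊤ := ENNReal.rpow_ne_top_of_nonneg hθ0.le hQt
  have h5 : ‖L‖ₑ ≤ ENNReal.ofReal (2 + D) * (P ^ (1 - θ) * Q ^ θ) := by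
    rw [← ofReal_norm, Real.norm_eq_abs]
    refine (ENNReal.ofReal_le_ofReal hLe).trans (le_of_eq ?_)
    rw [ENNReal.ofReal_mul (by linarith), ENNReal.toReal_rpow, ENNReal.toReal_rpow,
      ← ENNReal.toReal_mul, ENNReal.ofReal_toReal (by finiteness)]
  refine h5.trans (le_of_eq ?_)
  have h6 : P ^ (1 - θ) = (C * W) ^ (1 - θ) * V₁ ^ (1 - θ) * M ^ ((1 - θ) / α) := by
    rw [hP, ENNReal.mul_rpow_of_nonneg _ _ (by linarith), ENNReal.mul_rpow_of_nonneg _ _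
      (by linarith), ← ENNReal.rpow_mul M, one_div_mul_eq_div]
  have h7 : Q ^ θ = (C * W) ^ θ * V₂ ^ θ * N ^ θ := by
    rw [hQ, ENNReal.mul_rpow_of_nonneg _ _ hθ0.le, ENNReal.mul_rpow_of_nonneg _ _ hθ0.le]
  -- Both P and Q are linear in the norm of Ω, so their geometric mean is as well.
  have h8 : (C * W : ℝ≥0∞) ^ (1 - θ) * (C * W) ^ θ = C * W := by
    rw [← ENNReal.rpow_add_of_nonneg _ _ (by linarith) hθ0.le, sub_add_cancel, ENNReal.rpow_one]
  rw [h6, h7, hA]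
  calc _ = ENNReal.ofReal (2 + D) * (((C * W : ℝ≥0∞) ^ (1 - θ) * (C * W) ^ θ) *
        (V₁ ^ (1 - θ) * V₂ ^ θ)) * N ^ θ * M ^ ((1 - θ) / α) := by ring
    _ = _ := by rw [h8]; ring

theorem roughOp_eq {n : ℕ} {Ω : UnitSph n → ℝ} {f : Eucl n → ℝ} {x : Eucl n} {L : ℝ}
    (h : IsRoughPV Ω f x L) : roughOp Ω f x = L :=
  h.2.limUnder_eq

/-- For r ≥ 1 the Morrey growth r^(n-β) is at most r^n, so averages over large balls are uniformly
bounded. -/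
theorem hlMax_ae_lt_top_of_morreyNorm {n : ℕ} (hn : 0 < n) {F : Type*} [NormedAddCommGroup F]
    {α β : ℝ} (hα : 0 < α) (hβ : 0 < β) {g : Eucl n → F} (hN : morreyNorm α (α * n / β) g < ⊤) :
    ∀ᵐ x, hlMax (fun y => ‖g y‖ₑ ^ α) x < ⊤ := by
  set N := morreyNorm α (α * n / β) g with hNdef
  have hNα : N ^ α ≠ ⊤ := ENNReal.rpow_ne_top_of_nonneg hα.le hN.ne
  set v := volume (Metric.ball (0 : Eucl n) 1) with hv
  have hv0 : v ≠ 0 := volume_ball_ne_zero _ one_pos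
  have hvt : v ≠ ⊤ := volume_ball_ne_top _
  refine hlMax_ae_lt_top hn.ne' (N := N ^ α / v) (by finiteness) (fun r => ?_) fun x r hr => ?_
  · rcases le_or_gt r 0 with hr | hr
    · rw [Metric.ball_eq_empty.2 hr]; simp
    · refine ne_top_of_le_ne_top ?_ (lintegral_ball_le_morreyNorm (β := β) hn hα g 0 hr)
      rw [ENNReal.ofReal_rpow_of_pos hr]
      finiteness
  · have hr0 : 0 < r := by linarith
    refine (lintegral_ball_le_morreyNorm (β := β) hn hα g x hr0).trans ?_
    have h1 : volume (Metric.ball x r) = ENNReal.ofReal r ^ n * v := by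
      rw [hv, ← volume_ball_mul x 0 hr0, mul_one]
    have h2 : ENNReal.ofReal r ^ (n - β) ≤ ENNReal.ofReal r ^ n := by
      rw [← ENNReal.rpow_natCast]
      refine ENNReal.rpow_le_rpow_of_exponent_le ?_ (by linarith)
      rwa [ENNReal.one_le_ofReal]
    rw [h1, mul_left_comm, ENNReal.div_mul_cancel hv0 hvt]
    gcongr

/-! ### From the pointwise bound to the Lorentz estimate. -/

theorem mainTheorem5 (n : ℕ) (hn : 2 ≤ n) (ρ α β p : ℝ)
    (hρ : 1 < ρ) (hρn : ρ < n)
    (hα : ρ * n / (ρ * n + ρ - n) ≤ α) (h1α : 1 < α) (hαβ : α < β) (hβn : β < n)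
    (hαp : α < p) (K : ℝ≥0) :
    ∃ C : ℝ≥0, ∀ w : ℝ → ℝ≥0, IsBpWeight (p / α) K w →
      ∀ Ω : UnitSph n → ℝ, Integrable Ω (surfaceMeasure n) →
        MemLp Ω (ENNReal.ofReal ρ) (surfaceMeasure n) →
        ∫ θ, Ω θ ∂(surfaceMeasure n) = 0 →
        ∀ (f : Eucl n → ℝ) (gradf : Eucl n → Eucl n), HasWeakGradient f gradf →
          morreyNorm α (α * n / β) gradf < ⊤ →
          lorentzNorm p w gradf < ⊤ →
          (∀ᵐ x : Eucl n, ∃ L : ℝ, IsRoughPV Ω f x L) ∧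
          lorentzNorm (p / (1 - α / β)) w (roughOp Ω f) ≤
            (C : ℝ≥0∞) * eLpNorm Ω (ENNReal.ofReal ρ) (surfaceMeasure n) *
              morreyNorm α (α * n / β) gradf ^ (α / β) *
              lorentzNorm p w gradf ^ (1 - α / β) := by
  have hn0 : 0 < n := by omega
  have hα0 : 0 < α := by linarith
  have hβ0 : 0 < β := by linarith
  have hp0 : 0 < p := by linarith
  set θ := α / β with hθ
  have hθ1 : 0 < 1 - θ := sub_pos.2 ((div_lt_one hβ0).2 hαβ)
  set s := p / α with hs
  have hs1 : 1 < s := (one_lt_div hα0).2 hαp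
  have hs0 : 0 < s := by linarith
  set q := p / (1 - θ) with hq
  have hq0 : 0 < q := by positivity
  set κ := (1 - θ) / α with hκ
  have hκ0 : 0 < κ := by positivity
  -- The definition of q makes the q-th power of the pointwise bound carry the maximal function to
  -- the power s = p/α, the exponent of the weight class.
  have hκq : κ * q = s := by rw [hκ, hq, hs]; field_simp
  obtain ⟨C, hC⟩ := exists_roughPV_le hn0 (Real.HolderConjugate.conjExponent hρ) hρn hα h1α hαβ
  set B : ℝ≥0∞ := ((4 ^ n + 1) * (2 ^ s * (1 + K : ℝ≥0))) ^ s with hB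
  have hBq : B ^ (1 / q) ≠ ⊤ := by finiteness
  refine ⟨C * (B ^ (1 / q)).toNNReal, fun w hw Ω _ hΩ hΩ0 f g h hN _ => ?_⟩
  set G : Eucl n → ℝ≥0∞ := fun y => ‖g y‖ₑ ^ α with hG
  have hGm : AEMeasurable G := h.2.1.aestronglyMeasurable.enorm.pow_const α
  have hae := hlMax_ae_lt_top_of_morreyNorm hn0 hα0 hβ0 hN
  have hpt : ∀ᵐ x, ∃ L, IsRoughPV Ω f x L ∧
      ‖L‖ₑ ≤ C * eLpNorm Ω (ENNReal.ofReal ρ) (surfaceMeasure n) *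
        morreyNorm α (α * n / β) g ^ θ * hlMax G x ^ κ := by
    filter_upwards [hae] with x hx
    exact hC Ω hΩ hΩ0 f g h hN x hx
  refine ⟨hpt.mono fun x ⟨L, hL, _⟩ => ⟨L, hL⟩, ?_⟩
  set W := eLpNorm Ω (ENNReal.ofReal ρ) (surfaceMeasure n) with hW
  set N := morreyNorm α (α * n / β) g with hNdef
  have hct : C * W * N ^ θ ≠ ⊤ := by
    have h1 : N ^ θ ≠ ⊤ := ENNReal.rpow_ne_top_of_nonneg (by positivity) hN.ne
    have h2 : W ≠ ⊤ := hΩ.2.ne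
    finiteness
  set c : ℝ≥0∞ := C * W * N ^ θ with hc
  -- A monotone function of the maximal function dominates almost everywhere, so its rearrangement
  -- does too; the values of `roughOp` on the exceptional null set are irrelevant.
  have hre : ∀ t, rearrangement (roughOp Ω f) t ≤ c * decRearr volume (hlMax G) t ^ κ := by
    intro t
    refine decRearr_le_comp volume (φ := fun m => c * m ^ κ) ?_ ?_ t
    · intro a b hab
      show c * a ^ κ ≤ c * b ^ κ
      gcongr
    · filter_upwards [hpt] with x hx
      obtain ⟨L, hL, hLle⟩ := hx
      rw [roughOp_eq hL]
      exact hLle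
  have hGre : ∀ t, decRearr volume G t ^ s ≤ rearrangement g t ^ p := by
    intro t
    have h1 : decRearr volume G t ≤ rearrangement g t ^ α :=
      decRearr_le_comp volume (φ := fun m => m ^ α) (fun a b hab => by
        show a ^ α ≤ b ^ α
        gcongr) (Eventually.of_forall fun x => le_rfl) t
    calc _ ≤ (rearrangement g t ^ α) ^ s := by gcongr
      _ = _ := by rw [← ENNReal.rpow_mul, hs, mul_div_cancel₀ _ hα0.ne']
  have hcq : c ^ q ≠ ⊤ := ENNReal.rpow_ne_top_of_nonneg hq0.le hct
  have hint : ∫⁻ t in Ioi (0 : ℝ), rearrangement (roughOp Ω f) t ^ q * (w t : ℝ≥0∞) ≤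
      c ^ q * (B * ∫⁻ t in Ioi (0 : ℝ), rearrangement g t ^ p * (w t : ℝ≥0∞)) := by
    calc _ ≤ ∫⁻ t in Ioi (0 : ℝ), c ^ q * (decRearr volume (hlMax G) t ^ s * (w t : ℝ≥0∞)) := by
          refine lintegral_mono fun t => ?_
          rw [← mul_assoc]
          refine mul_le_mul' ?_ le_rfl
          refine (ENNReal.rpow_le_rpow (hre t) hq0.le).trans (le_of_eq ?_)
          rw [ENNReal.mul_rpow_of_nonneg _ _ hq0.le, ← ENNReal.rpow_mul, hκq]
      _ = c ^ q * ∫⁻ t in Ioi (0 : ℝ), decRearr volume (hlMax G) t ^ s * (w t : ℝ≥0∞) :=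
          lintegral_const_mul' _ _ hcq
      _ ≤ c ^ q * (B * ∫⁻ t in Ioi (0 : ℝ), decRearr volume G t ^ s * (w t : ℝ≥0∞)) := by
          gcongr
          exact lintegral_decRearr_hlMax_le hn0.ne' hGm hs1 hw
      _ ≤ _ := by
          gcongr with t
          exact hGre t
  rw [lorentzNorm, lorentzNorm]
  refine (ENNReal.rpow_le_rpow hint (by positivity)).trans (le_of_eq ?_)
  set J := ∫⁻ t in Ioi (0 : ℝ), rearrangement g t ^ p * (w t : ℝ≥0∞)
  rw [ENNReal.mul_rpow_of_nonneg (c ^ q) _ (by positivity), ENNReal.mul_rpow_of_nonneg B _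
    (by positivity), ← ENNReal.rpow_mul c, mul_one_div_cancel hq0.ne', ENNReal.rpow_one,
    ← ENNReal.rpow_mul J, show 1 / p * (1 - θ) = 1 / q by rw [hq]; field_simp, hc]
  push_cast
  rw [ENNReal.coe_toNNReal hBq]
  ring
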